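/- For a positive integer $n$ let $\omega(n)$ denote the number of distinct prime divisors of $n$ (so $\omega(1)=0$). Sums below run over the positive integers $n\le x$, where $x$ is real, and $\log$ is the natural logarithm. Then: (i) for all real $x\ge 1$, $$\sum_{n\le x}\frac{2^{\omega(n)}}{n}\ \le\ \frac{3}{\pi^{2}}\log^{2}x+1.3949\log x+0.4107+3.253\,x^{-1/3};$$ (ii) for all real $x>1$, $$\sum_{n\le x}2^{\omega(n)}\ \le\ \frac{6}{\pi^{2}}\,x\log x+0.787\,x-0.3762+8.14\,x^{2/3}.$$ -/

import Mathlib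

/-!
Write `2 ^ ω(n)` as the number of squarefree divisors of `n` and expand the indicator function of
the squarefree integers as `∑ d² ∣ e, μ(d)`. This reduces both sums to sums of the divisor function
(`sum_two_pow_omega_eq`):
`∑ n ≤ x, 2 ^ ω(n) / n = ∑ d ≤ √x, μ(d) / d² * G(x / d²)` with `G(t) = ∑ a b ≤ t, 1 / (a b)`, and
similarly for `∑ n ≤ x, 2 ^ ω(n)` with `∑ a b ≤ t, 1` in place of `G(t)`.

Dirichlet's hyperbola method (`pairSum_eq_hyperbola`) evaluates these inner sums with errors
`O(1 / √t)` and `O(√t)` (`abs_pairSum_inv_sub_le`, `abs_pairSum_one_sub_le`). Its inputs are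
Euler–Maclaurin bounds for harmonic numbers (`abs_harm_floor_sub_le`) and for the logarithmically
weighted harmonic sums (`logSum_floor_bounds`), both obtained from monotone sequences. In the main
term the sum over `d` is extended to infinity. The tail is compared with an integral
(`abs_sub_sum_le_of_quadratic_log`), and the complete series `∑ μ(d) logᵏ(d) / d²` are expressed
through `ζ(2)`, `ζ'(2)` and `ζ''(2)` (`moebiusLog_one_mul`, `moebiusLog_two_mul`). The total error
is of size `log x / √x`, respectively `√x log x`, which is smaller than the allowed `x ^ (-1 / 3)`,
respectively `x ^ (2 / 3)`.

The stated coefficients are close to the true ones, so numerical values are needed: the coefficient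
of `log x` has to be known to within `10⁻⁴` (`linear_coeff_le`), while for the constant term
(`constant_coeff_le`) an error of about `10⁻³` is harmless, since the rounding of the linear
coefficient and a part of the error term make up for it. The asymptotic argument proves the bound
for `∑ 2 ^ ω(n)` for all `x ≥ 1` and that for `∑ 2 ^ ω(n) / n` for `x ≥ 172`. Below `172` the latter
is checked at finitely many points, the bound being increasing in `x`.
-/

open Finset Real

/-! ### Harmonic numbers -/

/-- The `n`-th harmonic number, as a real number. -/
noncomputable def harm (n : ℕ) : ℝ := ∑ k ∈ Icc 1 n, (k : ℝ)⁻¹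

lemma harm_succ (n : ℕ) : harm (n + 1) = harm n + ((n : ℝ) + 1)⁻¹ := by
  rw [harm, harm, sum_Icc_succ_top (by omega)]
  push_cast
  rfl

/-- Partial sums of the series of `log ((1 + s) / (1 - s))` at `s = 1 / (2 n + 1)`; the upper bound
is the trapezoid rule for `∫ dt / t` over `[n, n + 1]`. -/
lemma log_succ_sub_log_bounds {n : ℝ} (hn : 1 ≤ n) :
    2 / (2 * n + 1) + 2 / (3 * (2 * n + 1) ^ 3) ≤ log (n + 1) - log n ∧
      log (n + 1) - log n ≤ (2 * n + 1) / (2 * n * (n + 1)) := by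
  have hz0 : (0 : ℝ) ≤ 1 / (2 * n + 1) := by positivity
  have hz1 : 1 / (2 * n + 1) < (1 : ℝ) := by
    rw [div_lt_one (by positivity)]; linarith
  have e : (1 + 1 / (2 * n + 1)) / (1 - 1 / (2 * n + 1)) = (n + 1) / n := by
    have : 2 * n + 1 - 1 ≠ 0 := by linarith
    field_simp
    ring
  have lo := sum_range_le_log_div hz0 hz1 2
  have hi := log_div_le_sum_range_add hz0 hz1 1
  rw [e, log_div (by linarith) (by linarith)] at lo hi
  simp [sum_range_succ] at lo hi
  constructor
  · have : 2 / (2 * n + 1) + 2 / (3 * (2 * n + 1) ^ 3)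
        = 2 * ((2 * n + 1)⁻¹ + ((2 * n + 1) ^ 3)⁻¹ / 3) := by field_simp
    rw [this]
    norm_num at lo
    linarith
  · have h1 : (2 * n + 1)⁻¹ + ((2 * n + 1) ^ 3)⁻¹ / (1 - ((2 * n + 1) ^ 2)⁻¹)
        = (2 * n + 1) / (4 * n * (n + 1)) := by
      have : (2 * n + 1) ^ 2 - 1 ≠ 0 := by nlinarith
      field_simp
      ring
    have h2 : (2 * n + 1) / (2 * n * (n + 1)) = 2 * ((2 * n + 1) / (4 * n * (n + 1))) := by
      field_simp; ring
    rw [h2]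
    linarith

/-- The difference between the `n`-th harmonic number and its main term `log n + γ`. -/
noncomputable def harmErr (n : ℕ) : ℝ := harm n - log n - eulerMascheroniConstant

lemma tendsto_harmErr : Filter.Tendsto harmErr Filter.atTop (nhds 0) := by
  have h := tendsto_harmonic_sub_log.sub_const eulerMascheroniConstant
  rw [sub_self] at h
  refine h.congr fun n => ?_
  simp [harmErr, harm, harmonic_eq_sum_Icc]

lemma harmErr_succ (n : ℕ) :
    harmErr (n + 1) = harmErr n + ((n : ℝ) + 1)⁻¹ - (log ((n : ℝ) + 1) - log n) := by
  rw [harmErr, harmErr, harm_succ]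
  push_cast
  ring

/-- The upper Euler–Maclaurin bound: `H n - log n - 1 / (2 n)` increases to `γ` by the trapezoid
rule for the convex function `1 / t`. -/
lemma harmErr_le {n : ℕ} (hn : 1 ≤ n) : harmErr n ≤ 1 / (2 * n) := by
  have hmono : Monotone fun m : ℕ => harmErr (m + 1) - 1 / (2 * ((m + 1 : ℕ) : ℝ)) := by
    refine monotone_nat_of_le_succ fun m => ?_
    have hm : (1 : ℝ) ≤ ((m + 1 : ℕ) : ℝ) := by
      push_cast; linarith [(Nat.cast_nonneg m : (0 : ℝ) ≤ m)]
    have h := (log_succ_sub_log_bounds hm).2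
    rw [harmErr_succ (m + 1)]
    have e : (((m + 1 + 1 : ℕ)) : ℝ) = ((m + 1 : ℕ) : ℝ) + 1 := by push_cast; ring
    rw [e]
    set x : ℝ := ((m + 1 : ℕ) : ℝ)
    have e2 : (x + 1)⁻¹ - 1 / (2 * (x + 1)) + 1 / (2 * x) = (2 * x + 1) / (2 * x * (x + 1)) := by
      field_simp; ring
    linarith
  have hlim : Filter.Tendsto (fun m : ℕ => harmErr (m + 1) - 1 / (2 * ((m + 1 : ℕ) : ℝ)))
      Filter.atTop (nhds 0) := by
    have h1 := tendsto_harmErr.comp (Filter.tendsto_add_atTop_nat 1)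
    have h2 := (tendsto_one_div_add_atTop_nhds_zero_nat (𝕜 := ℝ)).const_mul (1 / 2)
    have h3 := h1.sub h2
    simp only [mul_zero, sub_zero] at h3
    refine h3.congr fun m => ?_
    simp only [Function.comp_apply]
    push_cast
    field_simp
  obtain ⟨m, rfl⟩ := Nat.exists_eq_add_of_le' hn
  have := hmono.ge_of_tendsto hlim m
  linarith

lemma le_harmErr {n : ℕ} (hn : 1 ≤ n) : 1 / (2 * n) - 1 / (12 * (n : ℝ) ^ 2) ≤ harmErr n := by
  have hanti : Antitone fun m : ℕ => harmErr (m + 1) - 1 / (2 * ((m + 1 : ℕ) : ℝ))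
      + 1 / (12 * ((m + 1 : ℕ) : ℝ) ^ 2) := by
    refine antitone_nat_of_succ_le fun m => ?_
    have hm : (1 : ℝ) ≤ ((m + 1 : ℕ) : ℝ) := by
      push_cast; linarith [(Nat.cast_nonneg m : (0 : ℝ) ≤ m)]
    have h := (log_succ_sub_log_bounds hm).1
    rw [harmErr_succ (m + 1)]
    have e : (((m + 1 + 1 : ℕ)) : ℝ) = ((m + 1 : ℕ) : ℝ) + 1 := by push_cast; ring
    rw [e]
    set x : ℝ := ((m + 1 : ℕ) : ℝ)
    have e2 : (x + 1)⁻¹ - 1 / (2 * (x + 1)) + 1 / (2 * x) + 1 / (12 * (x + 1) ^ 2)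
        - 1 / (12 * x ^ 2) - (2 / (2 * x + 1) + 2 / (3 * (2 * x + 1) ^ 3))
        = - (2 * (x * (x + 1)) + 1) / (12 * x ^ 2 * (x + 1) ^ 2 * (2 * x + 1) ^ 3) := by
      field_simp; ring
    have e3 : - (2 * (x * (x + 1)) + 1) / (12 * x ^ 2 * (x + 1) ^ 2 * (2 * x + 1) ^ 3) ≤ 0 :=
      div_nonpos_of_nonpos_of_nonneg (by nlinarith) (by positivity)
    linarith
  have hlim : Filter.Tendsto (fun m : ℕ => harmErr (m + 1) - 1 / (2 * ((m + 1 : ℕ) : ℝ))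
      + 1 / (12 * ((m + 1 : ℕ) : ℝ) ^ 2)) Filter.atTop (nhds 0) := by
    have h1 := tendsto_harmErr.comp (Filter.tendsto_add_atTop_nat 1)
    have h0 := tendsto_one_div_add_atTop_nhds_zero_nat (𝕜 := ℝ)
    have h3 := (h1.sub (h0.const_mul (1 / 2))).add ((h0.pow 2).const_mul (1 / 12))
    have e : (0 : ℝ) - 1 / 2 * 0 + 1 / 12 * 0 ^ 2 = 0 := by norm_num
    rw [e] at h3
    refine h3.congr fun m => ?_
    simp only [Function.comp_apply]
    push_cast
    field_simp
  obtain ⟨m, rfl⟩ := Nat.exists_eq_add_of_le' hn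
  have := hanti.le_of_tendsto hlim m
  linarith

/-- The harmonic sum up to a real number `v`. The constant `13 / 24 = 1 / 2 + 1 / 24` comes from
the left limits at the integers `n ≥ 2`, where `n * harmErr n ≥ 1 / 2 - 1 / (12 n)`. -/
lemma abs_harm_floor_sub_le {v : ℝ} (hv : 1 ≤ v) :
    |harm ⌊v⌋₊ - log v - eulerMascheroniConstant| ≤ 13 / 24 / v := by
  set n := ⌊v⌋₊ with hn
  have hn1 : 1 ≤ n := Nat.le_floor (by simpa using hv)
  have hn1' : (1 : ℝ) ≤ n := by exact_mod_cast hn1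
  have hnv : (n : ℝ) ≤ v := Nat.floor_le (by linarith)
  have hvn : v < n + 1 := Nat.lt_floor_add_one v
  rw [abs_le]
  constructor
  · have h1 := le_harmErr (n := n + 1) (by omega)
    have h2 : 1 - v / (n + 1) ≤ log ((n + 1) / v) := by
      have := one_sub_inv_le_log_of_pos (x := ((n : ℝ) + 1) / v) (by positivity)
      rwa [inv_div] at this
    rw [log_div (by positivity) (by positivity)] at h2
    rw [harmErr, harm_succ] at h1
    push_cast at h1
    set M : ℝ := (n : ℝ) + 1
    have hM : 2 ≤ M := by simp only [M]; linarith
    have h3 : -(13 / 24 / v) ≤ -(13 / 24 / M) := by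
      rw [neg_le_neg_iff]; gcongr
    have h4 : -(13 / 24 / M) ≤ 1 / (2 * M) - 1 / (12 * M ^ 2) - M⁻¹ + (1 - v / M) := by
      have : 1 / (2 * M) - 1 / (12 * M ^ 2) - M⁻¹ + (1 - v / M) + 13 / 24 / M
        = ((M - v) * M + (M - 2) / 24) / M ^ 2 := by
        field_simp; ring
      have : 0 ≤ ((M - v) * M + (M - 2) / 24) / M ^ 2 :=
        div_nonneg (by nlinarith) (by positivity)
      linarith
    linarith
  · have h1 := harmErr_le hn1
    have h2 : 1 - n / v ≤ log (v / n) := by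
      have := one_sub_inv_le_log_of_pos (x := v / n) (by positivity)
      rwa [inv_div] at this
    rw [log_div (by positivity) (by positivity)] at h2
    rw [harmErr] at h1
    have h4 : 1 / (2 * n) - (1 - n / v) ≤ 13 / 24 / v := by
      have : 13 / 24 / v - (1 / (2 * n) - (1 - n / v))
        = ((v - n) * (n - 1 / 2) + n / 24) / (n * v) := by
        field_simp; ring
      have : 0 ≤ ((v - n) * (n - 1 / 2) + n / 24) / (n * v) :=
        div_nonneg (by nlinarith) (by positivity)
      linarith
    linarith

/-! ### Numerical values -/

lemma log_seven_bounds : 1.945909 < log 7 ∧ log 7 < 1.945912 := by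
  have h := log_succ_sub_log_bounds (n := 49) (by norm_num)
  have e1 : log (49 + 1) = log 2 + 2 * log 5 := by
    rw [show (49 + 1 : ℝ) = 2 * 5 ^ 2 by norm_num, log_mul (by norm_num) (by norm_num), log_pow]
    norm_num
  have e2 : log 49 = 2 * log 7 := by
    rw [show (49 : ℝ) = 7 ^ 2 by norm_num, log_pow]; norm_num
  rw [e1, e2] at h
  have h1 := log_two_gt_d9
  have h2 := log_two_lt_d9
  have h3 := log_five_gt_d9
  have h4 := log_five_lt_d9
  norm_num at h
  constructor <;> linarith [h.1, h.2]

lemma log_eleven_bounds : 2.397894 < log 11 ∧ log 11 < 2.397897 := by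
  have h := log_succ_sub_log_bounds (n := 120) (by norm_num)
  have e1 : log (120 + 1) = 2 * log 11 := by
    rw [show (120 + 1 : ℝ) = 11 ^ 2 by norm_num, log_pow]; norm_num
  have e2 : log 120 = 3 * log 2 + log 3 + log 5 := by
    rw [show (120 : ℝ) = 2 ^ 3 * 3 * 5 by norm_num, log_mul (by norm_num) (by norm_num),
      log_mul (by norm_num) (by norm_num), log_pow]
    norm_num
  rw [e1, e2] at h
  have h1 := log_two_gt_d9
  have h2 := log_two_lt_d9
  have h3 := log_five_gt_d9
  have h4 := log_five_lt_d9
  have h5 := log_three_gt_d9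
  have h6 := log_three_lt_d9
  norm_num at h
  constructor <;> linarith [h.1, h.2]

lemma log_thirteen_bounds : 2.564948 < log 13 ∧ log 13 < 2.564951 := by
  have h := log_succ_sub_log_bounds (n := 168) (by norm_num)
  have e1 : log (168 + 1) = 2 * log 13 := by
    rw [show (168 + 1 : ℝ) = 13 ^ 2 by norm_num, log_pow]; norm_num
  have e2 : log 168 = 3 * log 2 + log 3 + log 7 := by
    rw [show (168 : ℝ) = 2 ^ 3 * 3 * 7 by norm_num, log_mul (by norm_num) (by norm_num),
      log_mul (by norm_num) (by norm_num), log_pow]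
    norm_num
  rw [e1, e2] at h
  have h1 := log_two_gt_d9
  have h2 := log_two_lt_d9
  have h3 := log_seven_bounds
  have h5 := log_three_gt_d9
  have h6 := log_three_lt_d9
  norm_num at h
  constructor <;> linarith [h.1, h.2, h3.1, h3.2]

lemma log_seventeen_bounds : 2.833213 < log 17 ∧ log 17 < 2.833214 := by
  have h := log_succ_sub_log_bounds (n := 288) (by norm_num)
  have e1 : log (288 + 1) = 2 * log 17 := by
    rw [show (288 + 1 : ℝ) = 17 ^ 2 by norm_num, log_pow]; norm_num
  have e2 : log 288 = 5 * log 2 + 2 * log 3 := by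
    rw [show (288 : ℝ) = 2 ^ 5 * 3 ^ 2 by norm_num, log_mul (by norm_num) (by norm_num),
      log_pow, log_pow]
    norm_num
  rw [e1, e2] at h
  have h1 := log_two_gt_d9
  have h2 := log_two_lt_d9
  have h5 := log_three_gt_d9
  have h6 := log_three_lt_d9
  norm_num at h
  constructor <;> linarith [h.1, h.2]

lemma log_nineteen_bounds : 2.944438 < log 19 ∧ log 19 < 2.944440 := by
  have h := log_succ_sub_log_bounds (n := 360) (by norm_num)
  have e1 : log (360 + 1) = 2 * log 19 := by
    rw [show (360 + 1 : ℝ) = 19 ^ 2 by norm_num, log_pow]; norm_num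
  have e2 : log 360 = 3 * log 2 + 2 * log 3 + log 5 := by
    rw [show (360 : ℝ) = 2 ^ 3 * 3 ^ 2 * 5 by norm_num, log_mul (by norm_num) (by norm_num),
      log_mul (by norm_num) (by norm_num), log_pow, log_pow]
    norm_num
  rw [e1, e2] at h
  have h1 := log_two_gt_d9
  have h2 := log_two_lt_d9
  have h3 := log_five_gt_d9
  have h4 := log_five_lt_d9
  have h5 := log_three_gt_d9
  have h6 := log_three_lt_d9
  norm_num at h
  constructor <;> linarith [h.1, h.2]

/-- Expansions of the logarithms of the composite integers up to `20` in those of the primes. -/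
lemma log_composites : log 4 = 2 * log 2 ∧ log 6 = log 2 + log 3 ∧ log 8 = 3 * log 2 ∧
    log 9 = 2 * log 3 ∧ log 10 = log 2 + log 5 ∧ log 12 = 2 * log 2 + log 3 ∧
    log 14 = log 2 + log 7 ∧ log 15 = log 3 + log 5 ∧ log 16 = 4 * log 2 ∧
    log 18 = log 2 + 2 * log 3 ∧ log 20 = 2 * log 2 + log 5 := by
  refine ⟨?_, ?_, ?_, ?_, ?_, ?_, ?_, ?_, ?_, ?_, ?_⟩
  · rw [show (4 : ℝ) = 2 ^ 2 by norm_num, log_pow]; norm_num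
  · rw [show (6 : ℝ) = 2 * 3 by norm_num, log_mul (by norm_num) (by norm_num)]
  · rw [show (8 : ℝ) = 2 ^ 3 by norm_num, log_pow]; norm_num
  · rw [show (9 : ℝ) = 3 ^ 2 by norm_num, log_pow]; norm_num
  · rw [show (10 : ℝ) = 2 * 5 by norm_num, log_mul (by norm_num) (by norm_num)]
  · rw [show (12 : ℝ) = 2 ^ 2 * 3 by norm_num, log_mul (by norm_num) (by norm_num), log_pow]
    norm_num
  · rw [show (14 : ℝ) = 2 * 7 by norm_num, log_mul (by norm_num) (by norm_num)]
  · rw [show (15 : ℝ) = 3 * 5 by norm_num, log_mul (by norm_num) (by norm_num)]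
  · rw [show (16 : ℝ) = 2 ^ 4 by norm_num, log_pow]; norm_num
  · rw [show (18 : ℝ) = 2 * 3 ^ 2 by norm_num, log_mul (by norm_num) (by norm_num), log_pow]
    norm_num
  · rw [show (20 : ℝ) = 2 ^ 2 * 5 by norm_num, log_mul (by norm_num) (by norm_num), log_pow]
    norm_num

/-- Obtained from the harmonic number of `32`, whose logarithm is a multiple of `log 2`. -/
lemma eulerMascheroniConstant_bounds :
    0.577134 < eulerMascheroniConstant ∧ eulerMascheroniConstant < 0.577216 := by
  have h1 := harmErr_le (n := 32) (by norm_num)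
  have h2 := le_harmErr (n := 32) (by norm_num)
  have e : log ((32 : ℕ) : ℝ) = 5 * log 2 := by
    rw [show ((32 : ℕ) : ℝ) = 2 ^ 5 by norm_num, log_pow]; norm_num
  rw [harmErr, e, harm] at h1 h2
  norm_num [sum_Icc_succ_top] at h1 h2
  have h3 := log_two_gt_d9
  have h4 := log_two_lt_d9
  constructor <;> linarith

/-! ### Logarithmically weighted harmonic sums -/

/-- The error at the integer `n` in
`∑ a ≤ n, log (n / a) / a = log n ^ 2 / 2 + γ * log n + const + o(1)`, constant included. -/
noncomputable def logErr (n : ℕ) : ℝ :=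
  log n * harm n - ∑ a ∈ Icc 1 n, log a / a - log n ^ 2 / 2 - eulerMascheroniConstant * log n

lemma logErr_succ (n : ℕ) : logErr (n + 1) = logErr n
    + (log ((n : ℝ) + 1) - log n) * (harmErr n - (log ((n : ℝ) + 1) - log n) / 2) := by
  rw [logErr, logErr, harm_succ, sum_Icc_succ_top (by omega), harmErr]
  push_cast
  ring

lemma log_succ_sub_log_le_two_mul_harmErr {n : ℕ} (hn : 1 ≤ n) :
    log ((n : ℝ) + 1) - log n ≤ 2 * harmErr n := by
  have hn' : (1 : ℝ) ≤ n := by exact_mod_cast hn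
  have h1 := (log_succ_sub_log_bounds hn').2
  have h2 := le_harmErr hn
  have e : 2 * (1 / (2 * n) - 1 / (12 * (n : ℝ) ^ 2)) - (2 * n + 1) / (2 * n * (n + 1))
      = (2 * n - 1) / (6 * n ^ 2 * (n + 1)) := by
    field_simp; ring
  have : 0 ≤ (2 * (n : ℝ) - 1) / (6 * n ^ 2 * (n + 1)) :=
    div_nonneg (by linarith) (by positivity)
  linarith

lemma log_succ_sub_log_nonneg (n : ℕ) : 0 ≤ log ((n : ℝ) + 1) - log n := by
  rcases Nat.eq_zero_or_pos n with rfl | hn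
  · simp
  · have : (0 : ℝ) < n := by exact_mod_cast hn
    linarith [log_le_log this (by linarith : (n : ℝ) ≤ n + 1)]

lemma monotone_logErr : Monotone fun m : ℕ => logErr (m + 1) := by
  refine monotone_nat_of_le_succ fun m => ?_
  rw [logErr_succ (m + 1)]
  have h1 := log_succ_sub_log_le_two_mul_harmErr (n := m + 1) (by omega)
  have := mul_nonneg (log_succ_sub_log_nonneg (m + 1)) (by linarith :
    0 ≤ harmErr (m + 1) - (log (((m + 1 : ℕ) : ℝ) + 1) - log (m + 1 : ℕ)) / 2)
  linarith

lemma antitone_logErr_add :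
    Antitone fun m : ℕ => logErr (m + 1) + 1 / (2 * (2 * ((m + 1 : ℕ) : ℝ) - 1) ^ 2) := by
  refine antitone_nat_of_succ_le fun m => ?_
  have hm : (1 : ℝ) ≤ ((m + 1 : ℕ) : ℝ) := by
      push_cast; linarith [(Nat.cast_nonneg m : (0 : ℝ) ≤ m)]
  rw [logErr_succ (m + 1)]
  have h1 := harmErr_le (n := m + 1) (by omega)
  have h0 := log_succ_sub_log_nonneg (m + 1)
  obtain ⟨h2, -⟩ := log_succ_sub_log_bounds hm
  have h3 : log (((m + 1 : ℕ) : ℝ) + 1) - log (m + 1 : ℕ) ≤ 1 / ((m + 1 : ℕ) : ℝ) := by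
    rw [← log_div (by positivity) (by positivity)]
    refine (log_le_sub_one_of_pos (by positivity)).trans (le_of_eq ?_)
    field_simp; ring
  have e : (((m + 1 + 1 : ℕ)) : ℝ) = ((m + 1 : ℕ) : ℝ) + 1 := by push_cast; ring
  rw [e]
  set x : ℝ := ((m + 1 : ℕ) : ℝ)
  set δ := log (x + 1) - log x
  have h4 : harmErr (m + 1) - δ / 2 ≤ 1 / (2 * x * (2 * x + 1)) := by
    have : 1 / (2 * x) - (2 / (2 * x + 1)) / 2 = 1 / (2 * x * (2 * x + 1)) := by
      field_simp; ring
    have : 0 ≤ 2 / (3 * (2 * x + 1) ^ 3) := by positivity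
    linarith
  have h5 : δ * (harmErr (m + 1) - δ / 2) ≤ 1 / x * (1 / (2 * x * (2 * x + 1))) :=
    (mul_le_mul_of_nonneg_left h4 h0).trans (mul_le_mul_of_nonneg_right h3 (by positivity))
  have h6 : 1 / (2 * (2 * x - 1) ^ 2) - 1 / (2 * (2 * (x + 1) - 1) ^ 2)
      - 1 / x * (1 / (2 * x * (2 * x + 1)))
      = (4 * x ^ 2 + 2 * x - 1) / (2 * x ^ 2 * (2 * x - 1) ^ 2 * (2 * x + 1) ^ 2) := by
    have : 2 * x - 1 ≠ 0 := by linarith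
    have : 2 * (x + 1) - 1 ≠ 0 := by linarith
    field_simp; ring
  have h7 : 0 ≤ (4 * x ^ 2 + 2 * x - 1) / (2 * x ^ 2 * (2 * x - 1) ^ 2 * (2 * x + 1) ^ 2) :=
    div_nonneg (by nlinarith) (by positivity)
  linarith

/-- The constant in `∑ a ≤ u, log (u / a) / a = log u ^ 2 / 2 + γ * log u + const + o(1)`; it is
minus the first Stieltjes constant. -/
noncomputable def logConst : ℝ := ⨆ m : ℕ, logErr (m + 1)

lemma logErr_le_logErr_add {m n : ℕ} (hm : 1 ≤ m) (hn : 1 ≤ n) :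
    logErr m ≤ logErr n + 1 / (2 * (2 * (n : ℝ) - 1) ^ 2) := by
  obtain ⟨m, rfl⟩ := Nat.exists_eq_add_of_le' hm
  obtain ⟨n, rfl⟩ := Nat.exists_eq_add_of_le' hn
  have h1 := monotone_logErr (le_max_left m n)
  have h2 := antitone_logErr_add (le_max_right m n)
  simp only at h1 h2
  have h3 : 0 ≤ 1 / (2 * (2 * ((max m n + 1 : ℕ) : ℝ) - 1) ^ 2) := by positivity
  linarith

lemma logErr_le_logConst {n : ℕ} (hn : 1 ≤ n) : logErr n ≤ logConst := by
  obtain ⟨n, rfl⟩ := Nat.exists_eq_add_of_le' hn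
  refine le_ciSup (f := fun m : ℕ => logErr (m + 1))
    ⟨logErr 1 + 1 / (2 * (2 * ((1 : ℕ) : ℝ) - 1) ^ 2), ?_⟩ n
  rintro _ ⟨m, rfl⟩
  exact logErr_le_logErr_add (by omega) le_rfl

lemma logConst_le {n : ℕ} (hn : 1 ≤ n) :
    logConst ≤ logErr n + 1 / (2 * (2 * (n : ℝ) - 1) ^ 2) :=
  ciSup_le fun _ => logErr_le_logErr_add (by omega) hn

lemma logConst_nonneg : 0 ≤ logConst := by
  have := logErr_le_logConst (n := 1) le_rfl
  simpa [logErr] using this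

lemma logConst_lt : logConst < 0.0736 := by
  have h := logConst_le (n := 10) (by norm_num)
  obtain ⟨h4, h6, h8, h9, h10, -⟩ := log_composites
  rw [logErr, harm] at h
  norm_num [sum_Icc_succ_top] at h
  have g := eulerMascheroniConstant_bounds.1
  have b1 := log_two_gt_d9
  have b2 := log_two_lt_d9
  have b3 := log_three_gt_d9
  have b5 := log_five_gt_d9
  have b6 := log_five_lt_d9
  have b7 := log_seven_bounds.1
  have t0 : 2.3025850 < log 10 := by linarith
  have t1 : log 10 < 2.3025852 := by linarith
  have t2 : 2.3025850 ^ 2 < log 10 ^ 2 := by gcongr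
  have t3 : 0.577134 * log 10 ≤ eulerMascheroniConstant * log 10 := by gcongr
  rw [h4, h6, h8, h9] at h
  norm_num at t0 t1 t2 t3
  linarith

lemma logErr_two_gt : 0.05 < logErr 2 := by
  have b1 := log_two_gt_d9
  have b2 := log_two_lt_d9
  have g := eulerMascheroniConstant_bounds.2
  rw [logErr, harm]
  norm_num [sum_Icc_succ_top]
  nlinarith

/-- The general estimate `logConst_le` is too weak at `n = 1` and `n = 2`, where `logErr n` is
computed instead. -/
lemma logConst_sub_logErr_le {n : ℕ} (hn : 1 ≤ n) :
    logConst - logErr n ≤ 0.35 / ((n : ℝ) + 1) ^ 2 := by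
  rcases (by omega : n = 1 ∨ n = 2 ∨ 3 ≤ n) with rfl | rfl | h3
  · have := logConst_lt
    norm_num [logErr, harm]
    linarith
  · have := logConst_lt
    have := logErr_two_gt
    norm_num
    linarith
  · have h3' : (3 : ℝ) ≤ n := by exact_mod_cast h3
    have h := logConst_le hn
    have : 1 / (2 * (2 * (n : ℝ) - 1) ^ 2) ≤ 0.35 / ((n : ℝ) + 1) ^ 2 := by
      rw [div_le_div_iff₀ (by nlinarith) (by positivity)]
      nlinarith
    linarith

/-- `∑ a ≤ u, log (u / a) / a` up to a real number `u`, written by means of harmonic numbers. -/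
lemma logSum_floor_bounds {u : ℝ} (hu : 1 ≤ u) :
    logErr ⌊u⌋₊ ≤ log u * harm ⌊u⌋₊ - ∑ a ∈ Icc 1 ⌊u⌋₊, log a / a - log u ^ 2 / 2
        - eulerMascheroniConstant * log u ∧
      log u * harm ⌊u⌋₊ - ∑ a ∈ Icc 1 ⌊u⌋₊, log a / a - log u ^ 2 / 2
        - eulerMascheroniConstant * log u ≤ logErr ⌊u⌋₊ + 1 / (8 * (⌊u⌋₊ : ℝ) ^ 2) := by
  set n := ⌊u⌋₊ with hn
  have hn1 : 1 ≤ n := Nat.le_floor (by simpa using hu)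
  have hn1' : (1 : ℝ) ≤ n := by exact_mod_cast hn1
  have hnv : (n : ℝ) ≤ u := Nat.floor_le (by linarith)
  have hvn : u < n + 1 := Nat.lt_floor_add_one u
  have e : log u * harm n - ∑ a ∈ Icc 1 n, log a / a - log u ^ 2 / 2
        - eulerMascheroniConstant * log u
      = logErr n + (log u - log n) * (harmErr n - (log u - log n) / 2) := by
    rw [logErr, harmErr]; ring
  have h0 : 0 ≤ log u - log n := by linarith [log_le_log (by linarith) hnv]
  have h1 : log u - log n ≤ log ((n : ℝ) + 1) - log n := by
    linarith [log_le_log (by linarith) hvn.le]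
  have h2 := log_succ_sub_log_le_two_mul_harmErr hn1
  have h3 := harmErr_le hn1
  rw [e]
  constructor
  · have := mul_nonneg h0 (by linarith : 0 ≤ harmErr n - (log u - log n) / 2)
    linarith
  · have h4 : (log u - log n) * (harmErr n - (log u - log n) / 2) ≤ harmErr n ^ 2 / 2 := by
      nlinarith [sq_nonneg (log u - log n - harmErr n)]
    have h5 : harmErr n ^ 2 ≤ (1 / (2 * (n : ℝ))) ^ 2 := by
      gcongr
      linarith
    have h6 : (1 / (2 * (n : ℝ))) ^ 2 / 2 = 1 / (8 * (n : ℝ) ^ 2) := by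
      field_simp; norm_num
    linarith

/-! ### The hyperbola method -/

/-- The sum of `F a * F b` over the pairs of positive integers with `a * b ≤ n`. -/
noncomputable def pairSum (F : ℕ → ℝ) (n : ℕ) : ℝ :=
  ∑ a ∈ Icc 1 n, F a * ∑ b ∈ Icc 1 (n / a), F b

lemma pairSum_eq_sum_filter (F : ℕ → ℝ) (n : ℕ) :
    pairSum F n = ∑ p ∈ (Icc 1 n ×ˢ Icc 1 n) with p.1 * p.2 ≤ n, F p.1 * F p.2 := by
  rw [pairSum, sum_filter, sum_product]
  refine sum_congr rfl fun a ha => ?_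
  rw [mem_Icc] at ha
  rw [mul_sum, ← sum_filter]
  refine sum_congr ?_ fun _ _ => rfl
  ext b
  simp only [mem_Icc, mem_filter]
  rw [Nat.le_div_iff_mul_le (by omega), mul_comm b a]
  constructor
  · rintro ⟨h1, h2⟩
    exact ⟨⟨h1, le_trans (Nat.le_mul_of_pos_left b (by omega)) h2⟩, h2⟩
  · rintro ⟨⟨h1, -⟩, h2⟩
    exact ⟨h1, h2⟩

lemma pairSum_eq_hyperbola (F : ℕ → ℝ) {n m : ℕ} (h1 : m * m ≤ n) (h2 : n < (m + 1) * (m + 1)) :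
    pairSum F n = 2 * ∑ a ∈ Icc 1 m, F a * ∑ b ∈ Icc 1 (n / a), F b
      - (∑ a ∈ Icc 1 m, F a) ^ 2 := by
  classical
  set P := (Icc 1 n ×ˢ Icc 1 n).filter fun p : ℕ × ℕ => p.1 * p.2 ≤ n with hP
  have hmn : m ≤ n := le_trans (Nat.le_mul_self m) h1
  have hU : P = P.filter (fun p => p.1 ≤ m) ∪ P.filter (fun p => p.2 ≤ m) := by
    rw [← filter_or, eq_comm, filter_eq_self]
    rintro ⟨a, b⟩ hp
    simp only [hP, mem_filter] at hp
    by_contra! hc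
    have := Nat.mul_le_mul (Nat.succ_le_of_lt hc.1) (Nat.succ_le_of_lt hc.2)
    simp only [Nat.succ_eq_add_one] at this
    omega
  have hI : P.filter (fun p => p.1 ≤ m) ∩ P.filter (fun p => p.2 ≤ m)
      = Icc 1 m ×ˢ Icc 1 m := by
    ext ⟨a, b⟩
    simp only [hP, mem_inter, mem_filter, mem_product, mem_Icc]
    constructor
    · tauto
    · rintro ⟨⟨h3, h4⟩, h5, h6⟩
      have := Nat.mul_le_mul h4 h6
      refine ⟨⟨⟨⟨⟨h3, ?_⟩, h5, ?_⟩, ?_⟩, h4⟩, ⟨⟨⟨h3, ?_⟩, h5, ?_⟩, ?_⟩, h6⟩ <;> omega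
  have hA : ∑ p ∈ P.filter (fun p => p.1 ≤ m), F p.1 * F p.2
      = ∑ a ∈ Icc 1 m, F a * ∑ b ∈ Icc 1 (n / a), F b := by
    rw [hP, filter_filter, sum_filter, sum_product]
    have hsub : Icc 1 m ⊆ Icc 1 n := Icc_subset_Icc_right hmn
    rw [← sum_subset hsub]
    · refine sum_congr rfl fun a ha => ?_
      rw [mem_Icc] at ha
      rw [mul_sum, ← sum_filter]
      refine sum_congr ?_ fun _ _ => rfl
      ext b
      simp only [mem_Icc, mem_filter]
      rw [Nat.le_div_iff_mul_le (by omega), mul_comm b a]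
      constructor
      · rintro ⟨⟨h1, -⟩, h2, -⟩
        exact ⟨h1, h2⟩
      · rintro ⟨h1, h2⟩
        exact ⟨⟨h1, le_trans (Nat.le_mul_of_pos_left b (by omega)) h2⟩, h2, ha.2⟩
    · intro a ha ha'
      refine sum_eq_zero fun b _ => if_neg ?_
      simp only [mem_Icc] at ha ha'
      simp only [not_and]
      omega
  have hB : ∑ p ∈ P.filter (fun p => p.2 ≤ m), F p.1 * F p.2
      = ∑ p ∈ P.filter (fun p => p.1 ≤ m), F p.1 * F p.2 := by
    refine sum_nbij' Prod.swap Prod.swap ?_ ?_ ?_ ?_ ?_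
    · rintro ⟨a, b⟩ hp
      simp only [hP, mem_filter, mem_product, Prod.swap_prod_mk, mul_comm b a] at hp ⊢
      tauto
    · rintro ⟨a, b⟩ hp
      simp only [hP, mem_filter, mem_product, Prod.swap_prod_mk, mul_comm b a] at hp ⊢
      tauto
    · simp
    · simp
    · rintro ⟨a, b⟩ -
      simp [mul_comm]
  have hAB := sum_union_inter (s₁ := P.filter (fun p => p.1 ≤ m))
    (s₂ := P.filter (fun p => p.2 ≤ m)) (f := fun p => F p.1 * F p.2)
  rw [← hU, hI, hB, hA, sum_product] at hAB
  rw [pairSum_eq_sum_filter]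
  have : ∑ x ∈ Icc 1 m, ∑ y ∈ Icc 1 m, F x * F y = (∑ a ∈ Icc 1 m, F a) ^ 2 := by
    rw [sq, sum_mul_sum]
  simp only [this] at hAB
  linarith

lemma nat_floor_div {t : ℝ} (a : ℕ) : ⌊t⌋₊ / a = ⌊t / a⌋₊ := (Nat.floor_div_natCast t a).symm

lemma pairSum_floor_eq (F : ℕ → ℝ) {t : ℝ} (ht : 1 ≤ t) :
    pairSum F ⌊t⌋₊ = 2 * ∑ a ∈ Icc 1 ⌊√t⌋₊, F a * ∑ b ∈ Icc 1 ⌊t / a⌋₊, F b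
      - (∑ a ∈ Icc 1 ⌊√t⌋₊, F a) ^ 2 := by
  have h0 : (⌊√t⌋₊ : ℝ) ≤ √t := Nat.floor_le (sqrt_nonneg t)
  have h1 : √t < ⌊√t⌋₊ + 1 := Nat.lt_floor_add_one _
  have h2 : √t * √t = t := mul_self_sqrt (by linarith)
  rw [pairSum_eq_hyperbola F (m := ⌊√t⌋₊)]
  · simp only [nat_floor_div]
  · refine Nat.le_floor ?_
    push_cast
    nlinarith [(Nat.cast_nonneg ⌊√t⌋₊ : (0 : ℝ) ≤ _)]
  · rw [Nat.floor_lt (by linarith)]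
    push_cast
    nlinarith [sqrt_nonneg t]

/-! ### Sums of the divisor function -/

lemma one_le_div_of_le_floor_sqrt {t : ℝ} (ht : 1 ≤ t) {a : ℕ} (ha : a ∈ Icc 1 ⌊√t⌋₊) :
    1 ≤ t / a := by
  rw [mem_Icc] at ha
  have h1 : (1 : ℝ) ≤ a := by exact_mod_cast ha.1
  have h2 : (a : ℝ) ≤ √t := (Nat.le_floor_iff (sqrt_nonneg t)).1 ha.2
  have h3 : √t ≤ t := by
    rw [sqrt_le_left (by linarith)]; nlinarith
  rw [le_div_iff₀ (by linarith)]
  linarith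

/-- The sum of `d(n) / n` over `n ≤ t`, where `d` is the divisor function. -/
lemma abs_pairSum_inv_sub_le {t : ℝ} (ht : 1 ≤ t) :
    |pairSum (fun a => (a : ℝ)⁻¹) ⌊t⌋₊ - (log t ^ 2 / 2 + 2 * eulerMascheroniConstant * log t
      + (eulerMascheroniConstant ^ 2 + 2 * logConst))| ≤ 13 / 12 / √t + 1 / t := by
  have hu : 1 ≤ √t := by rwa [one_le_sqrt]
  have htu : t = √t * √t := (mul_self_sqrt (by linarith)).symm
  have hlog : log t = 2 * log √t := by
    rw [log_sqrt (by linarith)]; ring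
  set R := ∑ a ∈ Icc 1 ⌊√t⌋₊, (a : ℝ)⁻¹ *
    (harm ⌊t / a⌋₊ - log (t / a) - eulerMascheroniConstant) with hR
  have hRle : |R| ≤ 13 / 24 / √t := by
    refine (abs_sum_le_sum_abs _ _).trans ?_
    have h1 : ∀ a ∈ Icc 1 ⌊√t⌋₊, |(a : ℝ)⁻¹ *
        (harm ⌊t / a⌋₊ - log (t / a) - eulerMascheroniConstant)| ≤ 13 / 24 / t := by
      intro a ha
      have h2 := abs_harm_floor_sub_le (one_le_div_of_le_floor_sqrt ht ha)
      have ha0 : (0 : ℝ) < a := by exact_mod_cast (mem_Icc.1 ha).1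
      rw [abs_mul, abs_of_pos (inv_pos.2 ha0)]
      refine (mul_le_mul_of_nonneg_left h2 (by positivity)).trans (le_of_eq ?_)
      field_simp
    refine (sum_le_card_nsmul _ _ _ h1).trans ?_
    rw [Nat.card_Icc, nsmul_eq_mul, Nat.add_sub_cancel]
    have h3 : (⌊√t⌋₊ : ℝ) ≤ √t := Nat.floor_le (sqrt_nonneg t)
    calc (⌊√t⌋₊ : ℝ) * (13 / 24 / t) ≤ √t * (13 / 24 / t) := by gcongr
      _ = 13 / 24 / √t := by
        nth_rewrite 2 [htu]
        field_simp
  have hG : pairSum (fun a => (a : ℝ)⁻¹) ⌊t⌋₊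
      = 2 * ((log t + eulerMascheroniConstant) * harm ⌊√t⌋₊ - ∑ a ∈ Icc 1 ⌊√t⌋₊, log a / a + R)
        - harm ⌊√t⌋₊ ^ 2 := by
    rw [pairSum_floor_eq _ ht]
    congr 2
    rw [hR, harm, mul_sum, ← sum_sub_distrib, ← sum_add_distrib]
    refine sum_congr rfl fun a ha => ?_
    have ha0 : (0 : ℝ) < a := by exact_mod_cast (mem_Icc.1 ha).1
    rw [log_div (by linarith) ha0.ne', ← harm]
    field_simp
    ring
  obtain ⟨hF1, hF2⟩ := logSum_floor_bounds hu
  have hε := abs_harm_floor_sub_le hu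
  have hN1 : 1 ≤ ⌊√t⌋₊ := Nat.le_floor (by simpa using hu)
  have hN1' : (1 : ℝ) ≤ (⌊√t⌋₊ : ℝ) := by exact_mod_cast hN1
  have hNu : √t < ⌊√t⌋₊ + 1 := Nat.lt_floor_add_one _
  have hc1 := logErr_le_logConst hN1
  have hc2 := logConst_sub_logErr_le hN1
  rw [hG, hlog]
  set u := √t
  set N : ℝ := (⌊u⌋₊ : ℝ)
  set H := harm ⌊u⌋₊
  set g := eulerMascheroniConstant
  set ε := H - log u - g with hεdef
  set S := ∑ a ∈ Icc 1 ⌊u⌋₊, log a / a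
  set E := log u * H - S - log u ^ 2 / 2 - g * log u with hE
  have key : 2 * ((2 * log u + g) * H - S + R) - H ^ 2
      - ((2 * log u) ^ 2 / 2 + 2 * g * (2 * log u) + (g ^ 2 + 2 * logConst))
      = 2 * (E - logConst) - ε ^ 2 + 2 * R := by
    rw [hE, hεdef]; ring
  rw [key]
  have hε2 : ε ^ 2 ≤ 169 / 576 / t := by
    have : ε ^ 2 ≤ (13 / 24 / u) ^ 2 := by
      rw [← sq_abs]; gcongr
    refine this.trans (le_of_eq ?_)
    rw [htu]; field_simp; norm_num
  have hup : 2 * (1 / (8 * N ^ 2)) ≤ 1 / t := by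
    have : 2 * (1 / (8 * N ^ 2)) = 1 / (4 * N ^ 2) := by field_simp; norm_num
    rw [this, div_le_div_iff₀ (by positivity) (by linarith), htu]
    nlinarith
  have hlo : 2 * (0.35 / (N + 1) ^ 2) ≤ 0.7 / t := by
    have : 2 * (0.35 / (N + 1) ^ 2) = 0.7 / (N + 1) ^ 2 := by ring
    rw [this, htu]
    refine div_le_div_of_nonneg_left (by norm_num) (by positivity) (by nlinarith)
  have hk : 13 / 24 / u = 13 / 12 / u / 2 := by ring
  rw [hk] at hRle
  have ht1 : 169 / 576 / t + 0.7 / t ≤ 1 / t := by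
    rw [← add_div]; gcongr; norm_num
  rw [abs_le] at hRle ⊢
  have := sq_nonneg ε
  constructor <;> linarith [hRle.1, hRle.2]

/-- The sum of `d(n)` over `n ≤ t`, where `d` is the divisor function. -/
lemma abs_pairSum_one_sub_le {t : ℝ} (ht : 1 ≤ t) :
    |pairSum (fun _ => 1) ⌊t⌋₊ - t * (log t + 2 * eulerMascheroniConstant - 1)|
      ≤ 37 / 12 * √t := by
  have hu : 1 ≤ √t := by rwa [one_le_sqrt]
  have htu : t = √t * √t := (mul_self_sqrt (by linarith)).symm
  have hlog : log t = 2 * log √t := by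
    rw [log_sqrt (by linarith)]; ring
  set R := ∑ a ∈ Icc 1 ⌊√t⌋₊, (t / a - (⌊t / a⌋₊ : ℝ)) with hR
  have hR0 : 0 ≤ R := sum_nonneg fun a _ => by
    have := Nat.floor_le (show 0 ≤ t / (a : ℝ) by positivity)
    linarith
  have hR1 : R ≤ ⌊√t⌋₊ := by
    have := sum_le_card_nsmul (Icc 1 ⌊√t⌋₊) (fun a : ℕ => t / a - (⌊t / a⌋₊ : ℝ)) 1
      fun a _ => by linarith [Nat.lt_floor_add_one (t / (a : ℝ))]
    simpa only [nsmul_eq_mul, Nat.card_Icc, Nat.add_sub_cancel, mul_one] using this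
  have hD : pairSum (fun _ => 1) ⌊t⌋₊ = 2 * (t * harm ⌊√t⌋₊ - R) - (⌊√t⌋₊ : ℝ) ^ 2 := by
    rw [pairSum_floor_eq _ ht]
    congr 2
    · rw [hR, harm, mul_sum, ← sum_sub_distrib]
      refine sum_congr rfl fun a _ => ?_
      simp
      ring
    · simp
  have hε := abs_harm_floor_sub_le hu
  have hN1 : 1 ≤ ⌊√t⌋₊ := Nat.le_floor (by simpa using hu)
  have hNu : √t < ⌊√t⌋₊ + 1 := Nat.lt_floor_add_one _
  have hNu' : (⌊√t⌋₊ : ℝ) ≤ √t := Nat.floor_le (sqrt_nonneg t)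
  rw [hD, hlog]
  set u := √t
  set N : ℝ := (⌊u⌋₊ : ℝ)
  set H := harm ⌊u⌋₊
  set g := eulerMascheroniConstant
  have hε' : |t * (H - log u - g)| ≤ 13 / 24 * u := by
    rw [abs_mul, abs_of_nonneg (by linarith)]
    refine (mul_le_mul_of_nonneg_left hε (by linarith)).trans (le_of_eq ?_)
    nth_rewrite 1 [htu]
    field_simp
  have key : 2 * (t * H - R) - N ^ 2 - t * (2 * log u + 2 * g - 1)
      = 2 * (t * (H - log u - g)) - 2 * R + (t - N ^ 2) := by ring
  rw [key]
  have h1 : 0 ≤ t - N ^ 2 := by rw [htu]; nlinarith [(Nat.cast_nonneg _ : (0 : ℝ) ≤ N)]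
  have h2 : t - N ^ 2 ≤ 2 * u := by rw [htu]; nlinarith [(Nat.cast_nonneg _ : (0 : ℝ) ≤ N)]
  rw [abs_le] at hε' ⊢
  constructor <;> linarith [hε'.1, hε'.2]

/-! ### Reduction to the divisor function -/

lemma two_pow_cardDistinctFactors {n : ℕ} (hn : n ≠ 0) :
    2 ^ ArithmeticFunction.cardDistinctFactors n = #{e ∈ n.divisors | Squarefree e} := by
  rw [card_eq_sum_ones, Nat.sum_divisors_filter_squarefree hn, ← card_eq_sum_ones, card_powerset,
    ArithmeticFunction.cardDistinctFactors_apply]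
  congr 1
  rw [Nat.factors_eq]
  rfl

/-- Writing `n = b² a` with `a` squarefree, `d² ∣ n` holds exactly when `d ∣ b`. -/
lemma squarefree_ite_eq_sum_moebius {n X : ℕ} (hn : n ≠ 0) (hX : n < (X + 1) ^ 2) :
    (if Squarefree n then 1 else 0 : ℤ)
      = ∑ d ∈ Icc 1 X with d ^ 2 ∣ n, ArithmeticFunction.moebius d := by
  obtain ⟨a, b, hab, ha⟩ := Nat.sq_mul_squarefree n
  have hb : b ≠ 0 := by rintro rfl; simp at hab; omega
  have hset : ({d ∈ Icc 1 X | d ^ 2 ∣ n} : Finset ℕ) = b.divisors := by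
    ext d
    simp only [mem_filter, mem_Icc, Nat.mem_divisors]
    constructor
    · rintro ⟨⟨h1, h2⟩, h3⟩
      refine ⟨?_, hb⟩
      have ha0 : a ≠ 0 := ha.ne_zero
      rw [← hab, ← Nat.factorization_le_iff_dvd (by positivity) (by positivity)] at h3
      rw [← Nat.factorization_le_iff_dvd (by omega) hb]
      intro p
      have h4 := h3 p
      rw [Nat.factorization_mul (by positivity) ha0, Nat.factorization_pow,
        Nat.factorization_pow] at h4
      simp only [Finsupp.coe_add, Finsupp.coe_smul, Pi.add_apply, Pi.smul_apply, smul_eq_mul] at h4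
      have := ha.natFactorization_le_one p
      omega
    · rintro ⟨h1, h2⟩
      have h3 : d ^ 2 ∣ n := by
        rw [← hab]; exact Dvd.dvd.mul_right (pow_dvd_pow_of_dvd h1 2) _
      refine ⟨⟨Nat.pos_of_dvd_of_pos h1 (by omega), ?_⟩, h3⟩
      have h4 := Nat.le_of_dvd (by omega) h3
      have h5 : d < X + 1 := lt_of_pow_lt_pow_left₀ 2 (by omega) (h4.trans_lt hX)
      omega
  have hiff : Squarefree n ↔ b = 1 := by
    constructor
    · intro h
      exact Nat.isUnit_iff.1 (h b (by rw [← hab, sq]; exact dvd_mul_right _ _))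
    · rintro rfl
      rw [← hab]; simpa using ha
  rw [hset, ← ArithmeticFunction.coe_mul_zeta_apply, ArithmeticFunction.moebius_mul_coe_zeta,
    ArithmeticFunction.one_apply]
  simp only [hiff]

lemma sum_Icc_filter_dvd (f : ℕ → ℝ) {q : ℕ} (hq : q ≠ 0) (X : ℕ) :
    ∑ e ∈ Icc 1 X with q ∣ e, f e = ∑ a ∈ Icc 1 (X / q), f (q * a) := by
  refine (sum_nbij' (fun a => q * a) (fun e => e / q) ?_ ?_ ?_ ?_ ?_).symm
  · intro a ha
    rw [mem_Icc, Nat.le_div_iff_mul_le (by omega)] at ha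
    simp only [mem_filter, mem_Icc, dvd_mul_right, and_true]
    exact ⟨Nat.mul_pos (by omega) ha.1, by rw [mul_comm]; exact ha.2⟩
  · intro e he
    simp only [mem_filter, mem_Icc] at he ⊢
    exact ⟨Nat.div_pos (Nat.le_of_dvd (by omega) he.2) (by omega), Nat.div_le_div_right he.1.2⟩
  · intro a _
    exact Nat.mul_div_cancel_left a (by omega)
  · intro e he
    exact Nat.mul_div_cancel' (mem_filter.1 he).2
  · intro _ _
    rfl

/-- In Dirichlet series terms, `∑ 2 ^ ω(n) n⁻ˢ = ζ(s)² / ζ(2s)`: the convolution of the divisor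
function with the function `d² ↦ μ(d)`. -/
lemma sum_two_pow_omega_eq {F : ℕ → ℝ} (hF : ∀ m n, F (m * n) = F m * F n) {X Y : ℕ}
    (hXY : X < (Y + 1) ^ 2) :
    ∑ n ∈ Icc 1 X, (2 : ℝ) ^ ArithmeticFunction.cardDistinctFactors n * F n
      = ∑ d ∈ Icc 1 Y, (ArithmeticFunction.moebius d : ℝ) * F (d ^ 2) * pairSum F (X / d ^ 2) := by
  have h1 : ∀ n ∈ Icc 1 X, (2 : ℝ) ^ ArithmeticFunction.cardDistinctFactors n * F n
      = ∑ e ∈ Icc 1 X, if e ∣ n then (if Squarefree e then F n else 0) else 0 := by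
    intro n hn
    rw [mem_Icc] at hn
    have h2 : (2 : ℝ) ^ ArithmeticFunction.cardDistinctFactors n
        = #{e ∈ n.divisors | Squarefree e} := by
      exact_mod_cast two_pow_cardDistinctFactors (by omega)
    rw [h2, ← sum_filter, ← sum_filter, filter_filter, sum_const, nsmul_eq_mul]
    congr 3
    ext e
    simp only [mem_filter, mem_Icc, Nat.mem_divisors]
    constructor
    · rintro ⟨⟨h3, h4⟩, h5⟩
      have := Nat.le_of_dvd (by omega) h3
      have := Nat.pos_of_dvd_of_pos h3 (by omega)
      exact ⟨⟨by omega, by omega⟩, h3, h5⟩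
    · rintro ⟨⟨h3, h4⟩, h5, h6⟩
      exact ⟨⟨h5, by omega⟩, h6⟩
  rw [sum_congr rfl h1, sum_comm]
  have h2 : ∀ e ∈ Icc 1 X, (∑ n ∈ Icc 1 X, if e ∣ n then (if Squarefree e then F n else 0) else 0)
      = ∑ d ∈ Icc 1 Y, if d ^ 2 ∣ e then (ArithmeticFunction.moebius d : ℝ)
        * (F e * ∑ m ∈ Icc 1 (X / e), F m) else 0 := by
    intro e he
    rw [mem_Icc] at he
    have h3 := squarefree_ite_eq_sum_moebius (n := e) (X := Y) (by omega) (by omega)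
    have h4 : (if Squarefree e then 1 else 0 : ℝ)
        = ∑ d ∈ Icc 1 Y with d ^ 2 ∣ e, (ArithmeticFunction.moebius d : ℝ) := by
      have := congrArg (Int.cast (R := ℝ)) h3
      push_cast at this
      exact this
    have h5 : ∑ n ∈ Icc 1 X, (if e ∣ n then (if Squarefree e then F n else 0) else 0)
        = (if Squarefree e then 1 else 0 : ℝ) * (F e * ∑ m ∈ Icc 1 (X / e), F m) := by
      rw [← sum_filter, sum_Icc_filter_dvd (fun n => if Squarefree e then F n else 0) (by omega)]
      split_ifs
      · simp [hF, mul_sum]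
      · simp
    rw [h5, h4, sum_mul, sum_filter]
  rw [sum_congr rfl h2, sum_comm]
  refine sum_congr rfl fun d hd => ?_
  rw [mem_Icc] at hd
  have hd2 : d ^ 2 ≠ 0 := pow_ne_zero 2 (by omega)
  rw [← sum_filter, sum_Icc_filter_dvd _ hd2, pairSum, mul_sum]
  refine sum_congr rfl fun a _ => ?_
  rw [hF, Nat.div_div_eq_div_mul]
  ring

/-! ### The Möbius series `∑ μ(d) logᵏ(d) / d²` -/

lemma lseries_term_two (a : ℕ → ℝ) (n : ℕ) :
    LSeries.term (fun n => (a n : ℂ)) 2 n = ((a n / (n : ℝ) ^ 2 : ℝ) : ℂ) := by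
  rcases eq_or_ne n 0 with rfl | hn
  · simp
  · rw [LSeries.term_of_ne_zero hn]
    push_cast
    norm_num

lemma hasSum_convolution_div_sq {a b : ℕ → ℝ} (ha : Summable fun n : ℕ => a n / (n : ℝ) ^ 2)
    (hb : Summable fun n : ℕ => b n / (n : ℝ) ^ 2) :
    HasSum (fun n : ℕ => (∑ p ∈ n.divisorsAntidiagonal, a p.1 * b p.2) / (n : ℝ) ^ 2)
      ((∑' n : ℕ, a n / (n : ℝ) ^ 2) * ∑' n : ℕ, b n / (n : ℝ) ^ 2) := by
  have key : ∀ {a : ℕ → ℝ} {t : ℝ}, HasSum (fun n : ℕ => a n / (n : ℝ) ^ 2) t ↔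
      LSeriesHasSum (fun n => (a n : ℂ)) 2 t := by
    intro a t
    rw [LSeriesHasSum, ← Complex.hasSum_ofReal]
    exact iff_of_eq (congrArg (fun f => HasSum f (t : ℂ))
      (funext fun n => (lseries_term_two a n).symm))
  have h := (key.1 ha.hasSum).convolution (key.1 hb.hasSum)
  rw [LSeries.convolution_def] at h
  rw [key]
  simp only [Complex.ofReal_sum, Complex.ofReal_mul]
  exact h

lemma summable_log_pow_div_sq {k : ℕ} (hk : k ≤ 2) :
    Summable fun n : ℕ => log n ^ k / (n : ℝ) ^ 2 := by
  have h : Summable fun n : ℕ => 16 * (1 / (n : ℝ) ^ (3 / 2 : ℝ)) :=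
    (summable_one_div_nat_rpow.2 (by norm_num)).mul_left _
  refine Summable.of_nonneg_of_le (fun n => div_nonneg (pow_nonneg (log_natCast_nonneg n) k)
    (by positivity)) (fun n => ?_) h
  rcases Nat.eq_zero_or_pos n with rfl | hn
  · simp
  have hn' : (1 : ℝ) ≤ n := by exact_mod_cast hn
  have h1 : log n ≤ 4 * (n : ℝ) ^ (1 / 4 : ℝ) := by
    have := log_le_rpow_div (x := n) (by linarith) (ε := 1 / 4) (by norm_num)
    linarith
  have h2 : 1 ≤ 4 * (n : ℝ) ^ (1 / 4 : ℝ) := by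
    linarith [one_le_rpow hn' (show (0 : ℝ) ≤ 1 / 4 by norm_num)]
  have h3 : log n ^ k ≤ (4 * (n : ℝ) ^ (1 / 4 : ℝ)) ^ 2 :=
    (pow_le_pow_left₀ (log_natCast_nonneg n) h1 k).trans (pow_le_pow_right₀ h2 hk)
  have h4 : (4 * (n : ℝ) ^ (1 / 4 : ℝ)) ^ 2 = 16 * (n : ℝ) ^ (1 / 2 : ℝ) := by
    rw [mul_pow, ← rpow_natCast ((n : ℝ) ^ (1 / 4 : ℝ)), ← rpow_mul (by linarith)]
    norm_num
  have h5 : (n : ℝ) ^ 2 = (n : ℝ) ^ (1 / 2 : ℝ) * (n : ℝ) ^ (3 / 2 : ℝ) := by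
    rw [← rpow_add (by linarith), ← rpow_natCast]; norm_num
  calc log n ^ k / (n : ℝ) ^ 2 ≤ 16 * (n : ℝ) ^ (1 / 2 : ℝ) / (n : ℝ) ^ 2 := by
        rw [← h4]; gcongr
    _ = 16 * (1 / (n : ℝ) ^ (3 / 2 : ℝ)) := by
        rw [h5]
        have : (0 : ℝ) < (n : ℝ) ^ (1 / 2 : ℝ) := by positivity
        field_simp

lemma summable_moebius_mul_log_pow_div_sq {k : ℕ} (hk : k ≤ 2) :
    Summable fun n : ℕ => (ArithmeticFunction.moebius n : ℝ) * log n ^ k / (n : ℝ) ^ 2 := by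
  refine Summable.of_norm_bounded (summable_log_pow_div_sq hk) fun n => ?_
  have h1 : |(ArithmeticFunction.moebius n : ℝ)| ≤ 1 := by
    exact_mod_cast ArithmeticFunction.abs_moebius_le_one (n := n)
  have h2 := pow_nonneg (log_natCast_nonneg n) k
  rw [norm_eq_abs, abs_div, abs_mul, abs_of_nonneg h2, abs_of_nonneg (sq_nonneg (n : ℝ))]
  gcongr
  exact mul_le_of_le_one_left h2 h1

/-- The series `∑ logᵏ(n) / n²`, that is `(-1)ᵏ ζ⁽ᵏ⁾(2)`. -/
noncomputable def zetaLog (k : ℕ) : ℝ := ∑' n : ℕ, log n ^ k / (n : ℝ) ^ 2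

/-- The series `∑ μ(n) logᵏ(n) / n²`. -/
noncomputable def moebiusLog (k : ℕ) : ℝ :=
  ∑' n : ℕ, (ArithmeticFunction.moebius n : ℝ) * log n ^ k / (n : ℝ) ^ 2

lemma hasSum_moebiusLog {k : ℕ} (hk : k ≤ 2) :
    HasSum (fun n : ℕ => (ArithmeticFunction.moebius n : ℝ) * log n ^ k / (n : ℝ) ^ 2)
      (moebiusLog k) := (summable_moebius_mul_log_pow_div_sq hk).hasSum

lemma zetaLog_zero : zetaLog 0 = π ^ 2 / 6 := by
  simpa [zetaLog] using hasSum_zeta_two.tsum_eq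

lemma sum_divisorsAntidiagonal_moebius (n : ℕ) :
    ∑ p ∈ n.divisorsAntidiagonal, (ArithmeticFunction.moebius p.1 : ℝ)
      = if n = 1 then 1 else 0 := by
  have h := congrArg (fun f => (f n : ℤ)) ArithmeticFunction.moebius_mul_coe_zeta
  simp only [ArithmeticFunction.coe_mul_zeta_apply, ArithmeticFunction.one_apply] at h
  rw [Nat.sum_divisorsAntidiagonal (f := fun i _ => (ArithmeticFunction.moebius i : ℝ))]
  exact_mod_cast h

lemma hasSum_moebius_convolution {j k : ℕ} (hj : j ≤ 2) (hk : k ≤ 2) :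
    HasSum (fun n : ℕ => (∑ p ∈ n.divisorsAntidiagonal,
      (ArithmeticFunction.moebius p.1 : ℝ) * log p.1 ^ j * log p.2 ^ k) / (n : ℝ) ^ 2)
      (moebiusLog j * zetaLog k) := by
  unfold moebiusLog zetaLog
  exact hasSum_convolution_div_sq (a := fun n : ℕ => (ArithmeticFunction.moebius n : ℝ) * log n ^ j)
    (b := fun n : ℕ => log n ^ k) (summable_moebius_mul_log_pow_div_sq hj)
    (summable_log_pow_div_sq hk)

lemma log_eq_add_of_mem_divisorsAntidiagonal {n : ℕ} {p : ℕ × ℕ}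
    (hp : p ∈ n.divisorsAntidiagonal) : log n = log p.1 + log p.2 := by
  obtain ⟨h1, h2⟩ := Nat.mem_divisorsAntidiagonal.1 hp
  have h3 : p.1 ≠ 0 := by rintro h; simp [h] at h1; omega
  have h4 : p.2 ≠ 0 := by rintro h; simp [h] at h1; omega
  rw [← h1, Nat.cast_mul, log_mul (by exact_mod_cast h3) (by exact_mod_cast h4)]

lemma moebiusLog_zero_mul : moebiusLog 0 * zetaLog 0 = 1 := by
  refine (hasSum_moebius_convolution (j := 0) (k := 0) (by omega) (by omega)).unique ?_
  simp only [pow_zero, mul_one, sum_divisorsAntidiagonal_moebius]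
  convert hasSum_single
    (f := fun n : ℕ => (if n = 1 then (1 : ℝ) else 0) / (n : ℝ) ^ 2) 1 ?_ using 1
  · simp
  · intro n hn
    simp [hn]

/-- Multiplication by `log` is a derivation for the Dirichlet convolution, and it kills `μ * 1`. -/
lemma moebiusLog_one_mul : moebiusLog 1 * zetaLog 0 + moebiusLog 0 * zetaLog 1 = 0 := by
  refine ((hasSum_moebius_convolution (j := 1) (k := 0) (by omega) (by omega)).add
    (hasSum_moebius_convolution (j := 0) (k := 1) (by omega) (by omega))).unique ?_
  refine hasSum_zero.congr_fun fun n => ?_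
  rw [← add_div, ← sum_add_distrib]
  have : ∑ p ∈ n.divisorsAntidiagonal, ((ArithmeticFunction.moebius p.1 : ℝ) * log p.1 ^ 1
      * log p.2 ^ 0 + (ArithmeticFunction.moebius p.1 : ℝ) * log p.1 ^ 0 * log p.2 ^ 1)
      = log n * ∑ p ∈ n.divisorsAntidiagonal, (ArithmeticFunction.moebius p.1 : ℝ) := by
    rw [mul_sum]
    refine sum_congr rfl fun p hp => ?_
    rw [log_eq_add_of_mem_divisorsAntidiagonal hp]; ring
  rw [this, sum_divisorsAntidiagonal_moebius]
  split_ifs with h <;> simp [h]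

lemma moebiusLog_two_mul :
    moebiusLog 2 * zetaLog 0 + 2 * (moebiusLog 1 * zetaLog 1) + moebiusLog 0 * zetaLog 2 = 0 := by
  refine (((hasSum_moebius_convolution (j := 2) (k := 0) (by omega) (by omega)).add
    ((hasSum_moebius_convolution (j := 1) (k := 1) (by omega) (by omega)).mul_left 2)).add
    (hasSum_moebius_convolution (j := 0) (k := 2) (by omega) (by omega))).unique ?_
  refine hasSum_zero.congr_fun fun n => ?_
  rw [← mul_div_assoc, ← add_div, ← add_div, mul_sum, ← sum_add_distrib, ← sum_add_distrib]
  have : ∑ p ∈ n.divisorsAntidiagonal, ((ArithmeticFunction.moebius p.1 : ℝ) * log p.1 ^ 2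
      * log p.2 ^ 0 + 2 * ((ArithmeticFunction.moebius p.1 : ℝ) * log p.1 ^ 1 * log p.2 ^ 1)
      + (ArithmeticFunction.moebius p.1 : ℝ) * log p.1 ^ 0 * log p.2 ^ 2)
      = log n ^ 2 * ∑ p ∈ n.divisorsAntidiagonal, (ArithmeticFunction.moebius p.1 : ℝ) := by
    rw [mul_sum]
    refine sum_congr rfl fun p hp => ?_
    rw [log_eq_add_of_mem_divisorsAntidiagonal hp]; ring
  rw [this, sum_divisorsAntidiagonal_moebius]
  split_ifs with h <;> simp [h]

/-! ### Comparison of sums with integrals -/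

/-- If `f` is convex and `Φ' = -f`, the value of `f` at `n` is at most its integral over
`[n - 1 / 2, n + 1 / 2]`. -/
lemma le_sub_of_convexOn_midpoint {f Φ : ℝ → ℝ} {n : ℝ}
    (hf : ConvexOn ℝ (Set.Icc (n - 1 / 2) (n + 1 / 2)) f)
    (hΦ : ∀ v ∈ Set.Icc (n - 1 / 2) (n + 1 / 2), HasDerivAt Φ (-f v) v) :
    f n ≤ Φ (n - 1 / 2) - Φ (n + 1 / 2) := by
  have hd : ∀ s ∈ Set.Icc (0 : ℝ) (1 / 2), HasDerivAt
      (fun s => Φ (n - s) - Φ (n + s) - 2 * s * f n) (f (n - s) + f (n + s) - 2 * f n) s := by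
    intro s hs
    have h1 := (hΦ (n - s) ⟨by linarith [hs.2], by linarith [hs.1]⟩).comp_const_sub n s
    have h2 := (hΦ (n + s) ⟨by linarith [hs.1], by linarith [hs.2]⟩).comp_const_add n s
    have h3 := ((hasDerivAt_id s).const_mul 2).mul_const (f n)
    exact ((h1.sub h2).sub h3).congr_deriv (by simp)
  have hm : MonotoneOn (fun s => Φ (n - s) - Φ (n + s) - 2 * s * f n)
      (Set.Icc (0 : ℝ) (1 / 2)) := by
    refine monotoneOn_of_hasDerivWithinAt_nonneg (convex_Icc _ _)
      (fun s hs => (hd s hs).continuousAt.continuousWithinAt)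
      (fun s hs => (hd s (interior_subset hs)).hasDerivWithinAt) fun s hs => ?_
    have hs := interior_subset hs
    have h := hf.2
      (show n - s ∈ Set.Icc (n - 1 / 2) (n + 1 / 2) from ⟨by linarith [hs.2], by linarith [hs.1]⟩)
      (show n + s ∈ Set.Icc (n - 1 / 2) (n + 1 / 2) from ⟨by linarith [hs.1], by linarith [hs.2]⟩)
      (show (0 : ℝ) ≤ 1 / 2 by norm_num) (show (0 : ℝ) ≤ 1 / 2 by norm_num) (by norm_num)
    simp only [smul_eq_mul] at h
    rw [show 1 / 2 * (n - s) + 1 / 2 * (n + s) = n by ring] at h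
    linarith
  have h := hm (Set.left_mem_Icc.2 (by norm_num)) (Set.right_mem_Icc.2 (by norm_num))
    (by norm_num : (0 : ℝ) ≤ 1 / 2)
  simp only at h
  norm_num at h ⊢
  linarith

/-- If `f` is convex and `Φ' = -f`, the trapezoid rule overestimates the integral of `f` over
`[n, n + 1]`. -/
lemma sub_le_of_convexOn_trapezoid {f f' Φ : ℝ → ℝ} {n : ℝ}
    (hf : MonotoneOn f' (Set.Icc n (n + 1)))
    (hf' : ∀ v ∈ Set.Icc n (n + 1), HasDerivAt f (f' v) v)
    (hΦ : ∀ v ∈ Set.Icc n (n + 1), HasDerivAt Φ (-f v) v) :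
    Φ n - Φ (n + 1) ≤ (f n + f (n + 1)) / 2 := by
  have hd : ∀ v ∈ Set.Icc n (n + 1), HasDerivAt
      (fun v => (v - n) * (f n + f v) / 2 + Φ v) (((f n - f v) + (v - n) * f' v) / 2) v := by
    intro v hv
    have h1 := (((hasDerivAt_id v).sub_const n).mul ((hf' v hv).const_add (f n))).div_const 2
    exact (h1.add (hΦ v hv)).congr_deriv (by simp; ring)
  have hm : MonotoneOn (fun v => (v - n) * (f n + f v) / 2 + Φ v) (Set.Icc n (n + 1)) := by
    refine monotoneOn_of_hasDerivWithinAt_nonneg (convex_Icc _ _)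
      (fun s hs => (hd s hs).continuousAt.continuousWithinAt)
      (fun s hs => (hd s (interior_subset hs)).hasDerivWithinAt) fun v hv => ?_
    rw [interior_Icc] at hv
    obtain ⟨c, hc, hc'⟩ := exists_hasDerivAt_eq_slope f f' hv.1
      (fun w hw => (hf' w ⟨hw.1, hw.2.trans hv.2.le⟩).continuousAt.continuousWithinAt)
      (fun w hw => hf' w ⟨hw.1.le, hw.2.le.trans hv.2.le⟩)
    have h1 := hf ⟨hc.1.le, hc.2.le.trans hv.2.le⟩ ⟨hv.1.le, hv.2.le⟩ hc.2.le
    rw [hc', div_le_iff₀ (by linarith [hv.1])] at h1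
    linarith
  have h := hm (Set.left_mem_Icc.2 (by linarith)) (Set.right_mem_Icc.2 (by linarith))
    (by linarith : n ≤ n + 1)
  simp only [sub_self, zero_mul, zero_div, zero_add, add_sub_cancel_left, one_mul] at h
  linarith

/-! ### Values of the derivatives of `ζ` at `2` -/

lemma hasDerivAt_log_antideriv {v : ℝ} (hv : 0 < v) :
    HasDerivAt (fun v => (log v + 1) / v) (-(log v / v ^ 2)) v := by
  have h := ((hasDerivAt_log hv.ne').add_const 1).div (hasDerivAt_id v) hv.ne'
  refine h.congr_deriv ?_
  simp only [id]
  field_simp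
  ring

lemma convexOn_log_div_sq : ConvexOn ℝ (Set.Ici 3) fun v => log v / v ^ 2 := by
  have hd : ∀ v ∈ Set.Ici (3 : ℝ), HasDerivAt (fun v => log v / v ^ 2)
      ((1 - 2 * log v) / v ^ 3) v := by
    intro v hv
    have hv : (3 : ℝ) ≤ v := hv
    have h := (hasDerivAt_log (x := v) (by linarith)).div (hasDerivAt_pow 2 v) (by positivity)
    refine h.congr_deriv ?_
    field_simp
    ring
  have hd2 : ∀ v ∈ Set.Ici (3 : ℝ), HasDerivAt (fun v => (1 - 2 * log v) / v ^ 3)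
      ((6 * log v - 5) / v ^ 4) v := by
    intro v hv
    have hv : (3 : ℝ) ≤ v := hv
    have h := (((hasDerivAt_log (x := v) (by linarith)).const_mul 2).const_sub 1).div
      (hasDerivAt_pow 3 v) (by positivity)
    refine h.congr_deriv ?_
    field_simp
    ring
  refine convexOn_of_hasDerivWithinAt2_nonneg (convex_Ici 3)
    (fun v hv => (hd v hv).continuousAt.continuousWithinAt)
    (fun v hv => (hd v (interior_subset hv)).hasDerivWithinAt)
    (fun v hv => (hd2 v (interior_subset hv)).hasDerivWithinAt) fun v hv => ?_
  have hv : (3 : ℝ) ≤ v := interior_subset hv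
  have := log_le_log (by norm_num) hv
  have := log_three_gt_d9
  exact div_nonneg (by linarith) (by positivity)

lemma hasDerivAt_log_sq_antideriv {v : ℝ} (hv : 0 < v) :
    HasDerivAt (fun v => (log v ^ 2 + 2 * log v + 2) / v) (-(log v ^ 2 / v ^ 2)) v := by
  have hl := hasDerivAt_log hv.ne'
  have h := (((hl.pow 2).add (hl.const_mul 2)).add_const 2).div (hasDerivAt_id v) hv.ne'
  refine h.congr_deriv ?_
  simp only [id, Pi.add_apply, Pi.pow_apply]
  field_simp
  ring

lemma hasDerivAt_log_sq_div_sq {v : ℝ} (hv : 0 < v) :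
    HasDerivAt (fun v => log v ^ 2 / v ^ 2) ((2 * log v - 2 * log v ^ 2) / v ^ 3) v := by
  have h := ((hasDerivAt_log hv.ne').pow 2).div (hasDerivAt_pow 2 v) (by positivity)
  refine h.congr_deriv ?_
  simp only [Pi.pow_apply]
  field_simp
  ring

lemma monotoneOn_deriv_log_sq_div_sq :
    MonotoneOn (fun v => (2 * log v - 2 * log v ^ 2) / v ^ 3) (Set.Ici 9) := by
  have hd2 : ∀ v ∈ Set.Ici (9 : ℝ), HasDerivAt (fun v => (2 * log v - 2 * log v ^ 2) / v ^ 3)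
      ((6 * log v ^ 2 - 10 * log v + 2) / v ^ 4) v := by
    intro v hv
    have hv : (9 : ℝ) ≤ v := hv
    have hl := hasDerivAt_log (x := v) (by linarith)
    have h := ((hl.const_mul 2).sub ((hl.pow 2).const_mul 2)).div
      (hasDerivAt_pow 3 v) (by positivity)
    refine h.congr_deriv ?_
    simp only [Pi.pow_apply, Pi.sub_apply]
    field_simp
    ring
  refine monotoneOn_of_hasDerivWithinAt_nonneg (convex_Ici 9)
    (fun v hv => (hd2 v hv).continuousAt.continuousWithinAt)
    (fun v hv => (hd2 v (interior_subset hv)).hasDerivWithinAt) fun v hv => ?_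
  have hv : (9 : ℝ) ≤ v := interior_subset hv
  have h1 := log_le_log (by norm_num) hv
  have h2 := log_three_gt_d9
  obtain ⟨-, -, -, h9, -⟩ := log_composites
  exact div_nonneg (by nlinarith) (by positivity)


/-- Twenty terms of `-ζ'(2)`, and the midpoint rule for the tail. -/
lemma zetaLog_one_le : zetaLog 1 ≤ 0.937574 := by
  have hstep : ∀ n : ℕ, 20 ≤ n → log (n + 1 : ℕ) ^ 1 / ((n + 1 : ℕ) : ℝ) ^ 2 ≤
      (log ((n : ℝ) + 1 / 2) + 1) / ((n : ℝ) + 1 / 2)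
        - (log (((n + 1 : ℕ) : ℝ) + 1 / 2) + 1) / (((n + 1 : ℕ) : ℝ) + 1 / 2) := by
    intro n hn
    have hn' : (20 : ℝ) ≤ n := by exact_mod_cast hn
    have h := le_sub_of_convexOn_midpoint (n := ((n + 1 : ℕ) : ℝ))
      (convexOn_log_div_sq.subset (fun v hv => ?_) (convex_Icc _ _))
      (fun v hv => hasDerivAt_log_antideriv ?_)
    · have e : ((n + 1 : ℕ) : ℝ) - 1 / 2 = (n : ℝ) + 1 / 2 := by push_cast; ring
      rw [e] at h
      simpa only [pow_one] using h
    · have := hv.1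
      push_cast at this
      exact Set.mem_Ici.2 (by linarith)
    · have := hv.1
      push_cast at this
      linarith
  have hpart : ∀ M : ℕ, 20 ≤ M → ∑ n ∈ range (M + 1), log n ^ 1 / (n : ℝ) ^ 2 ≤
      ∑ n ∈ range 21, log n ^ 1 / (n : ℝ) ^ 2 + (log ((20 : ℝ) + 1 / 2) + 1) / ((20 : ℝ) + 1 / 2)
        - (log ((M : ℝ) + 1 / 2) + 1) / ((M : ℝ) + 1 / 2) := by
    intro M hM
    induction M, hM using Nat.le_induction with
    | base => norm_num
    | succ n hn ih =>
      rw [sum_range_succ]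
      linarith [hstep n hn]
  have hall : zetaLog 1 ≤ ∑ n ∈ range 21, log n ^ 1 / (n : ℝ) ^ 2
      + (log ((20 : ℝ) + 1 / 2) + 1) / ((20 : ℝ) + 1 / 2) := by
    have hnn : ∀ n : ℕ, 0 ≤ log n ^ 1 / (n : ℝ) ^ 2 := fun n =>
      div_nonneg (pow_nonneg (log_natCast_nonneg n) 1) (by positivity)
    refine Real.tsum_le_of_sum_range_le hnn fun M => ?_
    refine (sum_le_sum_of_subset_of_nonneg (range_subset_range.2
      (by omega : M ≤ (M + 20) + 1)) fun i _ _ => hnn i).trans ?_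
    have h1 := hpart (M + 20) (by omega)
    have h2 : 0 ≤ (log (((M + 20 : ℕ) : ℝ) + 1 / 2) + 1) / (((M + 20 : ℕ) : ℝ) + 1 / 2) := by
      refine div_nonneg (add_nonneg (log_nonneg ?_) zero_le_one) (by positivity)
      push_cast
      linarith [(Nat.cast_nonneg M : (0 : ℝ) ≤ M)]
    linarith
  obtain ⟨h4, h6, h8, h9, h10, h12, h14, h15, h16, h18, h20⟩ := log_composites
  have b2 := log_two_lt_d9
  have b2' := log_two_gt_d9
  have b3 := log_three_lt_d9
  have b5 := log_five_lt_d9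
  have b7 := log_seven_bounds.2
  have b11 := log_eleven_bounds.2
  have b13 := log_thirteen_bounds.2
  have b17 := log_seventeen_bounds.2
  have b19 := log_nineteen_bounds.2
  have b41 : log ((20 : ℝ) + 1 / 2) ≤ 2 * log 2 + log 5 + 81 / 3280 := by
    have h := (log_succ_sub_log_bounds (n := 40) (by norm_num)).2
    rw [show (40 : ℝ) = 20 * 2 by norm_num, log_mul (by norm_num) (by norm_num),
      show (20 * 2 + 1 : ℝ) = (20 + 1 / 2) * 2 by norm_num, log_mul (by norm_num) (by norm_num),
      h20] at h
    norm_num at h ⊢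
    linarith
  refine hall.trans ?_
  simp only [sum_range_succ, range_zero, sum_empty, pow_one]
  norm_num only [Nat.cast_ofNat, Nat.cast_zero, Nat.cast_one, log_one, log_zero] at b41 ⊢
  rw [h4, h6, h8, h9, h10, h12, h14, h15, h16, h18, h20]
  norm_num at b41 ⊢
  linarith

/-- Twenty terms of `ζ''(2)`, and the trapezoid rule for the tail, cut off at `10 ^ 7`. -/
lemma le_zetaLog_two : 1.989 ≤ zetaLog 2 := by
  have hstep : ∀ n : ℕ, 21 ≤ n → (log n ^ 2 + 2 * log n + 2) / (n : ℝ)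
        - (log (n + 1 : ℕ) ^ 2 + 2 * log (n + 1 : ℕ) + 2) / ((n + 1 : ℕ) : ℝ)
      ≤ (log n ^ 2 / (n : ℝ) ^ 2 + log (n + 1 : ℕ) ^ 2 / ((n + 1 : ℕ) : ℝ) ^ 2) / 2 := by
    intro n hn
    have hn' : (21 : ℝ) ≤ n := by exact_mod_cast hn
    have h := sub_le_of_convexOn_trapezoid (n := (n : ℝ))
      (monotoneOn_deriv_log_sq_div_sq.mono fun v hv => ?_)
      (fun v hv => hasDerivAt_log_sq_div_sq ?_) (fun v hv => hasDerivAt_log_sq_antideriv ?_)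
    · push_cast
      exact h
    · exact Set.mem_Ici.2 (by linarith [hv.1])
    · linarith [hv.1]
    · linarith [hv.1]
  have hpart : ∀ M : ℕ, 21 ≤ M → ∑ n ∈ range 21, log n ^ 2 / (n : ℝ) ^ 2
      + (log (21 : ℕ) ^ 2 + 2 * log (21 : ℕ) + 2) / ((21 : ℕ) : ℝ)
      + log (21 : ℕ) ^ 2 / ((21 : ℕ) : ℝ) ^ 2 / 2
      ≤ ∑ n ∈ range (M + 1), log n ^ 2 / (n : ℝ) ^ 2 + (log M ^ 2 + 2 * log M + 2) / (M : ℝ) := by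
    intro M hM
    suffices h : ∑ n ∈ range 21, log n ^ 2 / (n : ℝ) ^ 2
        + (log (21 : ℕ) ^ 2 + 2 * log (21 : ℕ) + 2) / ((21 : ℕ) : ℝ)
        + log (21 : ℕ) ^ 2 / ((21 : ℕ) : ℝ) ^ 2 / 2
        ≤ ∑ n ∈ range (M + 1), log n ^ 2 / (n : ℝ) ^ 2 + (log M ^ 2 + 2 * log M + 2) / (M : ℝ)
          - log M ^ 2 / (M : ℝ) ^ 2 / 2 by
      have : 0 ≤ log M ^ 2 / (M : ℝ) ^ 2 / 2 := by positivity
      linarith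
    induction M, hM using Nat.le_induction with
    | base =>
      rw [sum_range_succ _ 21]
      linarith
    | succ n hn ih =>
      rw [sum_range_succ _ (n + 1)]
      linarith [hstep n hn]
  have hM := hpart (10 ^ 7) (by norm_num)
  have hle : ∑ n ∈ range (10 ^ 7 + 1), log n ^ 2 / (n : ℝ) ^ 2 ≤ zetaLog 2 :=
    (summable_log_pow_div_sq le_rfl).sum_le_tsum _ fun n _ => by positivity
  obtain ⟨h4, h6, h8, h9, h10, h12, h14, h15, h16, h18, h20⟩ := log_composites
  have b2 := log_two_gt_d9
  have b2' := log_two_lt_d9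
  have b3 := log_three_gt_d9
  have b5 := log_five_gt_d9
  have b5' := log_five_lt_d9
  have b7 := log_seven_bounds.1
  have b11 := log_eleven_bounds.1
  have b13 := log_thirteen_bounds.1
  have b17 := log_seventeen_bounds.1
  have b19 := log_nineteen_bounds.1
  have h21 : log 21 = log 3 + log 7 := by
    rw [show (21 : ℝ) = 3 * 7 by norm_num, log_mul (by norm_num) (by norm_num)]
  have q2 : 0.69314 ^ 2 ≤ log 2 ^ 2 := pow_le_pow_left₀ (by norm_num) (by linarith) 2
  have q3 : 1.09861 ^ 2 ≤ log 3 ^ 2 := pow_le_pow_left₀ (by norm_num) (by linarith) 2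
  have q4 : 1.38629 ^ 2 ≤ log 4 ^ 2 := pow_le_pow_left₀ (by norm_num) (by linarith) 2
  have q5 : 1.60943 ^ 2 ≤ log 5 ^ 2 := pow_le_pow_left₀ (by norm_num) (by linarith) 2
  have q6 : 1.79175 ^ 2 ≤ log 6 ^ 2 := pow_le_pow_left₀ (by norm_num) (by linarith) 2
  have q7 : 1.94590 ^ 2 ≤ log 7 ^ 2 := pow_le_pow_left₀ (by norm_num) (by linarith) 2
  have q8 : 2.07944 ^ 2 ≤ log 8 ^ 2 := pow_le_pow_left₀ (by norm_num) (by linarith) 2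
  have q9 : 2.19722 ^ 2 ≤ log 9 ^ 2 := pow_le_pow_left₀ (by norm_num) (by linarith) 2
  have q10 : 2.30258 ^ 2 ≤ log 10 ^ 2 := pow_le_pow_left₀ (by norm_num) (by linarith) 2
  have q11 : 2.39789 ^ 2 ≤ log 11 ^ 2 := pow_le_pow_left₀ (by norm_num) (by linarith) 2
  have q12 : 2.48490 ^ 2 ≤ log 12 ^ 2 := pow_le_pow_left₀ (by norm_num) (by linarith) 2
  have q13 : 2.56494 ^ 2 ≤ log 13 ^ 2 := pow_le_pow_left₀ (by norm_num) (by linarith) 2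
  have q14 : 2.63905 ^ 2 ≤ log 14 ^ 2 := pow_le_pow_left₀ (by norm_num) (by linarith) 2
  have q15 : 2.70805 ^ 2 ≤ log 15 ^ 2 := pow_le_pow_left₀ (by norm_num) (by linarith) 2
  have q16 : 2.77258 ^ 2 ≤ log 16 ^ 2 := pow_le_pow_left₀ (by norm_num) (by linarith) 2
  have q17 : 2.83321 ^ 2 ≤ log 17 ^ 2 := pow_le_pow_left₀ (by norm_num) (by linarith) 2
  have q18 : 2.89037 ^ 2 ≤ log 18 ^ 2 := pow_le_pow_left₀ (by norm_num) (by linarith) 2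
  have q19 : 2.94443 ^ 2 ≤ log 19 ^ 2 := pow_le_pow_left₀ (by norm_num) (by linarith) 2
  have q20 : 2.99573 ^ 2 ≤ log 20 ^ 2 := pow_le_pow_left₀ (by norm_num) (by linarith) 2
  have q21 : 3.0445 ^ 2 ≤ log 21 ^ 2 := pow_le_pow_left₀ (by norm_num) (by linarith) 2
  have hbig : (log ((10 ^ 7 : ℕ) : ℝ) ^ 2 + 2 * log ((10 ^ 7 : ℕ) : ℝ) + 2) / ((10 ^ 7 : ℕ) : ℝ)
      ≤ 0.00004 := by
    have e : log ((10 ^ 7 : ℕ) : ℝ) = 7 * log 10 := by rw [Nat.cast_pow, log_pow]; norm_num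
    have l1 : 7 * log 10 ≤ 16.2 := by linarith
    have l2 : (7 * log 10) ^ 2 ≤ 16.2 ^ 2 := pow_le_pow_left₀ (by linarith) l1 2
    rw [e, div_le_iff₀ (by positivity)]
    norm_num at l1 l2 ⊢
    linarith
  have hnum : 1.98905 ≤ ∑ n ∈ range 21, log n ^ 2 / (n : ℝ) ^ 2
      + (log (21 : ℕ) ^ 2 + 2 * log (21 : ℕ) + 2) / ((21 : ℕ) : ℝ)
      + log (21 : ℕ) ^ 2 / ((21 : ℕ) : ℝ) ^ 2 / 2 := by
    simp only [sum_range_succ, range_zero, sum_empty]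
    norm_num only [Nat.cast_ofNat, Nat.cast_zero, Nat.cast_one, log_one, log_zero]
    norm_num at q2 q3 q4 q5 q6 q7 q8 q9 q10 q11 q12 q13 q14 q15 q16 q17 q18 q19 q20 q21
    linarith
  linarith

lemma zetaLog_zero_inv_bounds : 0.607926 < (zetaLog 0)⁻¹ ∧ (zetaLog 0)⁻¹ < 0.6079274 := by
  have h1 := pi_gt_d6
  have h2 := pi_lt_d6
  rw [zetaLog_zero]
  have h3 : 3.141592 ^ 2 < π ^ 2 := by gcongr
  have h4 : π ^ 2 < 3.141593 ^ 2 := by gcongr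
  constructor
  · rw [lt_inv_comm₀ (by norm_num) (by positivity)]
    norm_num at h3 h4 ⊢
    linarith
  · rw [inv_lt_comm₀ (by positivity) (by norm_num)]
    norm_num at h3 h4 ⊢
    linarith

lemma moebiusLog_zero : moebiusLog 0 = (zetaLog 0)⁻¹ :=
  eq_inv_of_mul_eq_one_left moebiusLog_zero_mul

lemma moebiusLog_one : moebiusLog 1 = -(zetaLog 1 * (zetaLog 0)⁻¹ ^ 2) := by
  have h := moebiusLog_one_mul
  have h0 : zetaLog 0 ≠ 0 := by rw [zetaLog_zero]; positivity
  rw [moebiusLog_zero] at h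
  field_simp at h ⊢
  linarith

lemma moebiusLog_two :
    moebiusLog 2 = 2 * zetaLog 1 ^ 2 * (zetaLog 0)⁻¹ ^ 3 - zetaLog 2 * (zetaLog 0)⁻¹ ^ 2 := by
  have h := moebiusLog_two_mul
  have h0 : zetaLog 0 ≠ 0 := by rw [zetaLog_zero]; positivity
  rw [moebiusLog_zero, moebiusLog_one] at h
  field_simp at h ⊢
  linarith

lemma zetaLog_nonneg (k : ℕ) : 0 ≤ zetaLog k :=
  tsum_nonneg fun n => div_nonneg (pow_nonneg (log_natCast_nonneg n) k) (by positivity)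

/-- The coefficient of `log x` in `∑ n ≤ x, 2 ^ ω(n) / n`. -/
lemma linear_coeff_le :
    2 * eulerMascheroniConstant * moebiusLog 0 - 2 * moebiusLog 1 ≤ 1.394821 := by
  obtain ⟨w1, w2⟩ := zetaLog_zero_inv_bounds
  obtain ⟨g1, g2⟩ := eulerMascheroniConstant_bounds
  have hz := zetaLog_one_le
  have hz0 := zetaLog_nonneg 1
  rw [moebiusLog_one, moebiusLog_zero]
  set w := (zetaLog 0)⁻¹
  have h1 : eulerMascheroniConstant * w ≤ 0.577216 * 0.6079274 := by gcongr
  have h2 : zetaLog 1 * w ^ 2 ≤ 0.937574 * 0.6079274 ^ 2 := by gcongr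
  norm_num at h1 h2 ⊢
  linarith

/-- The constant term in `∑ n ≤ x, 2 ^ ω(n) / n`. -/
lemma constant_coeff_le :
    (eulerMascheroniConstant ^ 2 + 2 * logConst) * moebiusLog 0
      - 4 * eulerMascheroniConstant * moebiusLog 1 + 2 * moebiusLog 2 ≤ 0.412 := by
  obtain ⟨w1, w2⟩ := zetaLog_zero_inv_bounds
  obtain ⟨g1, g2⟩ := eulerMascheroniConstant_bounds
  have hz := zetaLog_one_le
  have hz0 := zetaLog_nonneg 1
  have hz2 := le_zetaLog_two
  have hl := logConst_lt
  have hl0 := logConst_nonneg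
  rw [moebiusLog_two, moebiusLog_one, moebiusLog_zero]
  set w := (zetaLog 0)⁻¹
  have h1 : (eulerMascheroniConstant ^ 2 + 2 * logConst) * w
      ≤ (0.577216 ^ 2 + 2 * 0.0736) * 0.6079274 := by gcongr
  have h2 : eulerMascheroniConstant * (zetaLog 1 * w ^ 2)
      ≤ 0.577216 * (0.937574 * 0.6079274 ^ 2) := by gcongr
  have h3 : zetaLog 1 ^ 2 * w ^ 3 ≤ 0.937574 ^ 2 * 0.6079274 ^ 3 := by gcongr
  have h4 : 1.989 * 0.607926 ^ 2 ≤ zetaLog 2 * w ^ 2 := by gcongr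
  norm_num at h1 h2 h3 h4 ⊢
  linarith

/-! ### Tails of the Möbius series -/

lemma hasDerivAt_quadratic_log_tail {p q c y v : ℝ} (hv : 0 < v) :
    HasDerivAt (fun v => (p * (log v - log y) ^ 2 + (q + 2 * p) * (log v - log y)
      + (c + q + 2 * p)) / v)
      (-((p * (log v - log y) ^ 2 + q * (log v - log y) + c) / v ^ 2)) v := by
  have hl := (hasDerivAt_log hv.ne').sub_const (log y)
  have h := ((((hl.pow 2).const_mul p).add (hl.const_mul (q + 2 * p))).add_const
    (c + q + 2 * p)).div (hasDerivAt_id v) hv.ne'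
  refine h.congr_deriv ?_
  simp only [id, Pi.add_apply, Pi.pow_apply]
  field_simp
  ring

lemma antitoneOn_quadratic_log_div_sq {p q c y : ℝ} (hy : 0 < y)
    (hpqc : ∀ w : ℝ, 0 ≤ w → 2 * p * w + q ≤ 2 * (p * w ^ 2 + q * w + c)) :
    AntitoneOn (fun v => (p * (log v - log y) ^ 2 + q * (log v - log y) + c) / v ^ 2)
      (Set.Ici y) := by
  have hd : ∀ v ∈ Set.Ici y, HasDerivAt
      (fun v => (p * (log v - log y) ^ 2 + q * (log v - log y) + c) / v ^ 2)
      ((2 * p * (log v - log y) + q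
        - 2 * (p * (log v - log y) ^ 2 + q * (log v - log y) + c)) / v ^ 3) v := by
    intro v hv
    have hv : 0 < v := lt_of_lt_of_le hy hv
    have hl := (hasDerivAt_log hv.ne').sub_const (log y)
    have h := ((((hl.pow 2).const_mul p).add (hl.const_mul q)).add_const c).div
      (hasDerivAt_pow 2 v) (by positivity)
    refine h.congr_deriv ?_
    simp only [Pi.add_apply, Pi.pow_apply]
    field_simp
    ring
  refine antitoneOn_of_hasDerivWithinAt_nonpos (convex_Ici y)
    (fun v hv => (hd v hv).continuousAt.continuousWithinAt)
    (fun v hv => (hd v (interior_subset hv)).hasDerivWithinAt) fun v hv => ?_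
  have hv : y ≤ v := interior_subset hv
  have h := hpqc (log v - log y) (by linarith [log_le_log hy hv])
  exact div_nonpos_of_nonpos_of_nonneg (by linarith) (by have := hy.trans_le hv; positivity)

/-- If the terms beyond `y` are dominated by `g(d) = (p w² + q w + c) / d²` with `w = log (d / y)`,
a decreasing function of `d`, the tail is at most `g(y)` plus the integral of `g` over `[y, ∞)`. -/
lemma abs_sub_sum_le_of_quadratic_log {f : ℕ → ℝ} {s p q c y : ℝ} (hy : 1 ≤ y) (hf : HasSum f s)
    (hpqc : ∀ w : ℝ, 0 ≤ w → 2 * p * w + q ≤ 2 * (p * w ^ 2 + q * w + c))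
    (hpqc0 : ∀ w : ℝ, 0 ≤ w → 0 ≤ p * w ^ 2 + q * w + c)
    (hpqc1 : ∀ w : ℝ, 0 ≤ w → 0 ≤ p * w ^ 2 + (q + 2 * p) * w + (c + q + 2 * p))
    (hbd : ∀ d : ℕ, y < d →
      |f d| ≤ (p * (log d - log y) ^ 2 + q * (log d - log y) + c) / (d : ℝ) ^ 2) :
    |s - ∑ d ∈ range (⌊y⌋₊ + 1), f d| ≤ c / y ^ 2 + (c + q + 2 * p) / y := by
  set g : ℝ → ℝ := fun v => (p * (log v - log y) ^ 2 + q * (log v - log y) + c) / v ^ 2 with hg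
  set Φ : ℝ → ℝ := fun v => (p * (log v - log y) ^ 2 + (q + 2 * p) * (log v - log y)
      + (c + q + 2 * p)) / v with hΦ
  have hy0 : 0 < y := by linarith
  have hanti := antitoneOn_quadratic_log_div_sq hy0 hpqc
  have hlog : ∀ {v : ℝ}, y ≤ v → 0 ≤ log v - log y := fun hv => by
    linarith [log_le_log hy0 hv]
  -- the integral of `g` over `[a, b]` exceeds `(b - a) g(b)` because `g` decreases
  have hstep : ∀ {a b : ℝ}, y ≤ a → a < b → (b - a) * g b ≤ Φ a - Φ b := by
    intro a b ha hab
    obtain ⟨ξ, hξ, hξ'⟩ := exists_hasDerivAt_eq_slope Φ (fun v => -g v) hab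
      (fun w hw => (hasDerivAt_quadratic_log_tail
        (by linarith [hw.1])).continuousAt.continuousWithinAt)
      (fun w hw => hasDerivAt_quadratic_log_tail (by linarith [hw.1]))
    have h1 : g b ≤ g ξ := hanti (show y ≤ ξ by linarith [hξ.1]) (show y ≤ b by linarith) hξ.2.le
    rw [eq_div_iff (by linarith)] at hξ'
    nlinarith
  set N := ⌊y⌋₊
  have hN : y < ((N + 1 : ℕ) : ℝ) := by push_cast; exact Nat.lt_floor_add_one y
  have hfirst : g ((N + 1 : ℕ) : ℝ) + Φ ((N + 1 : ℕ) : ℝ) ≤ g y + Φ y := by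
    have h1 : g ((N + 1 : ℕ) : ℝ) ≤ g y := hanti (Set.mem_Ici.2 le_rfl) (Set.mem_Ici.2 hN.le) hN.le
    have h2 := hstep le_rfl hN
    have h3 : 0 ≤ g ((N + 1 : ℕ) : ℝ) := div_nonneg (hpqc0 _ (hlog hN.le)) (by positivity)
    have := mul_nonneg (by linarith : 0 ≤ ((N + 1 : ℕ) : ℝ) - y) h3
    linarith
  have hpart : ∀ k : ℕ, |∑ d ∈ range (N + 1 + (k + 1)), f d - ∑ d ∈ range (N + 1), f d|
      ≤ g ((N + 1 : ℕ) : ℝ) + Φ ((N + 1 : ℕ) : ℝ) - Φ ((N + 1 + k : ℕ) : ℝ) := by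
    intro k
    induction k with
    | zero =>
      rw [zero_add, sum_range_succ]
      simpa using hbd (N + 1) hN
    | succ k ih =>
      have hk : y ≤ ((N + 1 + k : ℕ) : ℝ) := by
        push_cast at hN ⊢; linarith [(Nat.cast_nonneg k : (0 : ℝ) ≤ k)]
      have hk' : ((N + 1 + k : ℕ) : ℝ) < ((N + 1 + (k + 1) : ℕ) : ℝ) := by push_cast; linarith
      have h1 := hbd (N + 1 + (k + 1)) (by linarith)
      have h2 := hstep hk hk'
      have h3 : ((N + 1 + (k + 1) : ℕ) : ℝ) - ((N + 1 + k : ℕ) : ℝ) = 1 := by push_cast; ring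
      rw [h3, one_mul] at h2
      rw [show N + 1 + (k + 1 + 1) = (N + 1 + (k + 1)) + 1 by ring, sum_range_succ]
      have h4 := abs_add_le (∑ d ∈ range (N + 1 + (k + 1)), f d - ∑ d ∈ range (N + 1), f d)
        (f (N + 1 + (k + 1)))
      rw [show ∑ d ∈ range (N + 1 + (k + 1)), f d + f (N + 1 + (k + 1)) - ∑ d ∈ range (N + 1), f d
        = ∑ d ∈ range (N + 1 + (k + 1)), f d - ∑ d ∈ range (N + 1), f d + f (N + 1 + (k + 1))
        by ring]
      linarith
  have hgy : g y + Φ y = c / y ^ 2 + (c + q + 2 * p) / y := by simp [hg, hΦ]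
  have hlim := ((hf.tendsto_sum_nat.comp (Filter.tendsto_add_atTop_nat (N + 2))).sub_const
    (∑ d ∈ range (N + 1), f d)).abs
  refine le_of_tendsto' hlim fun k => ?_
  have h1 := hpart k
  have hk : y ≤ ((N + 1 + k : ℕ) : ℝ) := by
    push_cast at hN ⊢; linarith [(Nat.cast_nonneg k : (0 : ℝ) ≤ k)]
  have h2 : 0 ≤ Φ ((N + 1 + k : ℕ) : ℝ) := div_nonneg (hpqc1 _ (hlog hk)) (by positivity)
  simp only [Function.comp_apply]
  rw [show k + (N + 2) = N + 1 + (k + 1) by ring]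
  linarith

/-! ### The two sums with explicit error terms -/

lemma floor_lt_floor_sqrt_succ_sq {x : ℝ} (hx : 1 ≤ x) : ⌊x⌋₊ < (⌊√x⌋₊ + 1) ^ 2 := by
  rw [Nat.floor_lt (by linarith)]
  push_cast
  have h1 : √x < ⌊√x⌋₊ + 1 := Nat.lt_floor_add_one _
  have h2 : √x ^ 2 = x := sq_sqrt (by linarith)
  nlinarith [sqrt_nonneg x]

lemma one_le_div_sq_of_mem {x : ℝ} (hx : 1 ≤ x) {d : ℕ} (hd : d ∈ Icc 1 ⌊√x⌋₊) :
    (1 : ℝ) ≤ d ∧ 1 ≤ x / (d : ℝ) ^ 2 ∧ √(x / (d : ℝ) ^ 2) = √x / d ∧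
      log (x / (d : ℝ) ^ 2) = log x - 2 * log d := by
  rw [mem_Icc] at hd
  have h1 : (1 : ℝ) ≤ d := by exact_mod_cast hd.1
  have h2 : (d : ℝ) ≤ √x := (Nat.le_floor_iff (sqrt_nonneg x)).1 hd.2
  have h3 : √x ^ 2 = x := sq_sqrt (by linarith)
  refine ⟨h1, ?_, ?_, ?_⟩
  · rw [le_div_iff₀ (by positivity), ← h3, one_mul]
    gcongr
  · rw [sqrt_div (by linarith), sqrt_sq (by linarith)]
  · rw [log_div (by linarith) (by positivity), log_pow]
    norm_num

lemma harm_floor_sqrt_le {x : ℝ} (hx : 1 ≤ x) :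
    harm ⌊√x⌋₊ ≤ log x / 2 + eulerMascheroniConstant + 13 / 24 / √x := by
  have h := abs_harm_floor_sub_le (one_le_sqrt.2 hx)
  rw [log_sqrt (by linarith)] at h
  linarith [le_abs_self (harm ⌊√x⌋₊ - log x / 2 - eulerMascheroniConstant)]

lemma sum_range_floor_succ_eq (f : ℕ → ℝ) (hf : f 0 = 0) (N : ℕ) :
    ∑ d ∈ range (N + 1), f d = ∑ d ∈ Icc 1 N, f d := by
  rw [range_eq_Ico, sum_eq_sum_Ico_succ_bot (by omega), hf, zero_add]
  rfl

lemma abs_moebius_mul_div_sq_le {a b : ℝ} (h : |a| ≤ b) (d : ℕ) :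
    |(ArithmeticFunction.moebius d : ℝ) * a / (d : ℝ) ^ 2| ≤ b / (d : ℝ) ^ 2 := by
  have h1 : |(ArithmeticFunction.moebius d : ℝ)| ≤ 1 := by
    exact_mod_cast ArithmeticFunction.abs_moebius_le_one (n := d)
  rw [abs_div, abs_mul, abs_of_nonneg (sq_nonneg (d : ℝ))]
  gcongr
  nlinarith [abs_nonneg a]

/-- The sum `∑ n ≤ x, 2 ^ ω(n) / n`, with an error of size `log x / √x`. -/
lemma sum_two_pow_omega_div_le {x : ℝ} (hx : 1 ≤ x) :
    ∑ n ∈ Icc 1 ⌊x⌋₊, (2 : ℝ) ^ ArithmeticFunction.cardDistinctFactors n / (n : ℝ)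
      ≤ moebiusLog 0 * (log x ^ 2 / 2)
        + (2 * eulerMascheroniConstant * moebiusLog 0 - 2 * moebiusLog 1) * log x
        + ((eulerMascheroniConstant ^ 2 + 2 * logConst) * moebiusLog 0
          - 4 * eulerMascheroniConstant * moebiusLog 1 + 2 * moebiusLog 2)
        + (1.17 / x + (5.17 - 4 * eulerMascheroniConstant) / √x)
        + (13 / 12 * (log x / 2 + eulerMascheroniConstant + 13 / 24 / √x) + 1) / √x := by
  obtain ⟨g1, g2⟩ := eulerMascheroniConstant_bounds
  have k1 := logConst_lt
  have k0 := logConst_nonneg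
  have hy : 1 ≤ √x := one_le_sqrt.2 hx
  have hyx : √x ^ 2 = x := sq_sqrt (by linarith)
  set g := eulerMascheroniConstant
  set L := log x
  have hLy : log √x = L / 2 := log_sqrt (by linarith)
  -- the main term of `∑ m ≤ x / d², d(m) / m` as a function of `log d`
  set M : ℝ → ℝ := fun l => (L - 2 * l) ^ 2 / 2 + 2 * g * (L - 2 * l) + (g ^ 2 + 2 * logConst)
    with hM
  set f : ℕ → ℝ := fun d => (ArithmeticFunction.moebius d : ℝ) * M (log d) / (d : ℝ) ^ 2 with hf
  have hfsum : HasSum f (moebiusLog 0 * (L ^ 2 / 2)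
        + (2 * g * moebiusLog 0 - 2 * moebiusLog 1) * L
        + ((g ^ 2 + 2 * logConst) * moebiusLog 0
          - 4 * g * moebiusLog 1 + 2 * moebiusLog 2)) := by
    have h := (((hasSum_moebiusLog (k := 0) (by omega)).mul_left
      (L ^ 2 / 2 + 2 * g * L + (g ^ 2 + 2 * logConst))).add
      ((hasSum_moebiusLog (k := 1) (by omega)).mul_left (-2 * L - 4 * g))).add
      ((hasSum_moebiusLog (k := 2) (by omega)).mul_left 2)
    rw [show moebiusLog 0 * (L ^ 2 / 2) + (2 * g * moebiusLog 0 - 2 * moebiusLog 1) * L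
        + ((g ^ 2 + 2 * logConst) * moebiusLog 0 - 4 * g * moebiusLog 1 + 2 * moebiusLog 2)
      = (L ^ 2 / 2 + 2 * g * L + (g ^ 2 + 2 * logConst)) * moebiusLog 0
        + (-2 * L - 4 * g) * moebiusLog 1 + 2 * moebiusLog 2 by ring]
    refine h.congr_fun fun d => ?_
    simp only [hf, hM]
    ring
  have htail := abs_sub_sum_le_of_quadratic_log (p := 2) (q := -4 * g) (c := 1.17) hy hfsum
    (fun w _ => by nlinarith [sq_nonneg (w - (1 + 2 * g) / 2)])
    (fun w _ => by nlinarith [sq_nonneg (w - g)])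
    (fun w hw => by nlinarith [mul_nonneg (by linarith : 0 ≤ 4 - 4 * g) hw])
    (fun d _ => by
      refine abs_moebius_mul_div_sq_le ?_ d
      rw [hLy, hM, abs_le]
      constructor <;> nlinarith [sq_nonneg (log d - L / 2 - g)])
  rw [sum_range_floor_succ_eq f (by simp [hf])] at htail
  have hT : ∑ n ∈ Icc 1 ⌊x⌋₊, (2 : ℝ) ^ ArithmeticFunction.cardDistinctFactors n / (n : ℝ)
      = ∑ d ∈ Icc 1 ⌊√x⌋₊, (ArithmeticFunction.moebius d : ℝ)
        * pairSum (fun a => (a : ℝ)⁻¹) (⌊x⌋₊ / d ^ 2) / (d : ℝ) ^ 2 := by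
    have h := sum_two_pow_omega_eq (F := fun a : ℕ => (a : ℝ)⁻¹)
      (fun m n => by push_cast; rw [mul_inv]) (floor_lt_floor_sqrt_succ_sq hx)
    simp only [div_eq_mul_inv]
    rw [h]
    refine sum_congr rfl fun d _ => ?_
    push_cast
    ring
  have herr : ∑ d ∈ Icc 1 ⌊√x⌋₊, (ArithmeticFunction.moebius d : ℝ)
        * pairSum (fun a => (a : ℝ)⁻¹) (⌊x⌋₊ / d ^ 2) / (d : ℝ) ^ 2 - ∑ d ∈ Icc 1 ⌊√x⌋₊, f d
      ≤ (13 / 12 * harm ⌊√x⌋₊ + 1) / √x := by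
    have h1 : ∀ d ∈ Icc 1 ⌊√x⌋₊, (ArithmeticFunction.moebius d : ℝ)
        * pairSum (fun a => (a : ℝ)⁻¹) (⌊x⌋₊ / d ^ 2) / (d : ℝ) ^ 2 - f d
        ≤ 13 / 12 / √x * (d : ℝ)⁻¹ + 1 / x := by
      intro d hd
      obtain ⟨hd1, h2, h3, h4⟩ := one_le_div_sq_of_mem hx hd
      have h5 := abs_pairSum_inv_sub_le h2
      rw [h3, h4, show x / (d : ℝ) ^ 2 = x / ((d ^ 2 : ℕ) : ℝ) by push_cast; rfl,
        ← nat_floor_div] at h5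
      have h6 := (le_abs_self _).trans (abs_moebius_mul_div_sq_le h5 d)
      have h7 : (13 / 12 / (√x / d) + 1 / (x / ((d ^ 2 : ℕ) : ℝ))) / (d : ℝ) ^ 2
          = 13 / 12 / √x * (d : ℝ)⁻¹ + 1 / x := by
        push_cast
        field_simp
      rw [h7] at h6
      refine le_trans (le_of_eq ?_) h6
      simp only [hf, hM, L]
      ring
    rw [← sum_sub_distrib]
    refine (sum_le_sum h1).trans ?_
    rw [sum_add_distrib, ← mul_sum, ← harm, sum_const, Nat.card_Icc, nsmul_eq_mul,
      Nat.add_sub_cancel, add_div]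
    have h8 : (⌊√x⌋₊ : ℝ) ≤ √x := Nat.floor_le (sqrt_nonneg x)
    have h9 : (⌊√x⌋₊ : ℝ) * (1 / x) ≤ 1 / √x := by
      calc (⌊√x⌋₊ : ℝ) * (1 / x) ≤ √x * (1 / x) := by gcongr
        _ = 1 / √x := by
          nth_rewrite 2 [← hyx]
          field_simp
    have h10 : 13 / 12 / √x * harm ⌊√x⌋₊ = 13 / 12 * harm ⌊√x⌋₊ / √x := by ring
    linarith
  have hH := harm_floor_sqrt_le hx
  have hfin : (13 / 12 * harm ⌊√x⌋₊ + 1) / √x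
      ≤ (13 / 12 * (L / 2 + g + 13 / 24 / √x) + 1) / √x := by gcongr
  rw [hyx] at htail
  have h11 := neg_abs_le (moebiusLog 0 * (L ^ 2 / 2)
        + (2 * g * moebiusLog 0 - 2 * moebiusLog 1) * L
        + ((g ^ 2 + 2 * logConst) * moebiusLog 0
          - 4 * g * moebiusLog 1 + 2 * moebiusLog 2) - ∑ d ∈ Icc 1 ⌊√x⌋₊, f d)
  have h12 : (1.17 + -4 * g + 2 * 2) / √x = (5.17 - 4 * g) / √x := by ring
  rw [h12] at htail
  rw [hT]
  linarith

/-- The sum `∑ n ≤ x, 2 ^ ω(n)`, with an error of size `√x log x`. -/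
lemma sum_two_pow_omega_le {x : ℝ} (hx : 1 ≤ x) :
    ∑ n ∈ Icc 1 ⌊x⌋₊, (2 : ℝ) ^ ArithmeticFunction.cardDistinctFactors n
      ≤ x * (moebiusLog 0 * log x
          + (2 * eulerMascheroniConstant * moebiusLog 0 - 2 * moebiusLog 1) - moebiusLog 0)
        + (1 + 3 * √x)
        + 37 / 12 * √x * (log x / 2 + eulerMascheroniConstant + 13 / 24 / √x) := by
  obtain ⟨g1, g2⟩ := eulerMascheroniConstant_bounds
  have hy : 1 ≤ √x := one_le_sqrt.2 hx
  have hyx : √x ^ 2 = x := sq_sqrt (by linarith)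
  set g := eulerMascheroniConstant
  set L := log x
  have hLy : log √x = L / 2 := log_sqrt (by linarith)
  set f : ℕ → ℝ := fun d => (ArithmeticFunction.moebius d : ℝ) * (L - 2 * log d + 2 * g - 1)
    / (d : ℝ) ^ 2 with hf
  have hfsum : HasSum f (moebiusLog 0 * L
      + (2 * g * moebiusLog 0 - 2 * moebiusLog 1) - moebiusLog 0) := by
    have h := ((hasSum_moebiusLog (k := 0) (by omega)).mul_left (L + 2 * g - 1)).add
      ((hasSum_moebiusLog (k := 1) (by omega)).mul_left (-2))
    rw [show moebiusLog 0 * L + (2 * g * moebiusLog 0 - 2 * moebiusLog 1) - moebiusLog 0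
      = (L + 2 * g - 1) * moebiusLog 0 + -2 * moebiusLog 1 by ring]
    refine h.congr_fun fun d => ?_
    simp only [hf]
    ring
  have htail := abs_sub_sum_le_of_quadratic_log (p := 0) (q := 2) (c := 1) hy hfsum
    (fun w hw => by linarith) (fun w hw => by linarith) (fun w hw => by linarith)
    (fun d hd => by
      refine abs_moebius_mul_div_sq_le ?_ d
      have := log_le_log (by linarith) hd.le
      rw [hLy] at this ⊢
      rw [abs_le]
      constructor <;> linarith)
  rw [sum_range_floor_succ_eq f (by simp [hf])] at htail
  have hT : ∑ n ∈ Icc 1 ⌊x⌋₊, (2 : ℝ) ^ ArithmeticFunction.cardDistinctFactors n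
      = ∑ d ∈ Icc 1 ⌊√x⌋₊, (ArithmeticFunction.moebius d : ℝ)
        * pairSum (fun _ => 1) (⌊x⌋₊ / d ^ 2) := by
    have h := sum_two_pow_omega_eq (F := fun _ : ℕ => 1) (fun m n => by norm_num)
      (floor_lt_floor_sqrt_succ_sq hx)
    simpa only [mul_one] using h
  have herr : ∑ d ∈ Icc 1 ⌊√x⌋₊, (ArithmeticFunction.moebius d : ℝ)
        * pairSum (fun _ => 1) (⌊x⌋₊ / d ^ 2) - x * ∑ d ∈ Icc 1 ⌊√x⌋₊, f d
      ≤ 37 / 12 * √x * harm ⌊√x⌋₊ := by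
    rw [mul_sum, ← sum_sub_distrib, harm, mul_sum]
    refine sum_le_sum fun d hd => ?_
    obtain ⟨hd1, h2, h3, h4⟩ := one_le_div_sq_of_mem hx hd
    have h5 := abs_pairSum_one_sub_le h2
    rw [h3, h4, show pairSum (fun _ => 1) ⌊x / (d : ℝ) ^ 2⌋₊
      = pairSum (fun _ => 1) (⌊x⌋₊ / d ^ 2) by rw [nat_floor_div]; push_cast; rfl] at h5
    have h1 : |(ArithmeticFunction.moebius d : ℝ)| ≤ 1 := by
      exact_mod_cast ArithmeticFunction.abs_moebius_le_one (n := d)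
    have h6 : (ArithmeticFunction.moebius d : ℝ) * (pairSum (fun _ => 1) (⌊x⌋₊ / d ^ 2)
        - x / (d : ℝ) ^ 2 * (L - 2 * log d + 2 * g - 1)) ≤ 37 / 12 * (√x / d) := by
      refine (le_abs_self _).trans ?_
      rw [abs_mul]
      refine (mul_le_mul h1 h5 (abs_nonneg _) zero_le_one).trans (le_of_eq (one_mul _))
    refine le_trans (le_of_eq ?_) (h6.trans (le_of_eq ?_))
    · simp only [hf]
      ring
    · ring
  have hH := harm_floor_sqrt_le hx
  have hfin : 37 / 12 * √x * harm ⌊√x⌋₊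
      ≤ 37 / 12 * √x * (L / 2 + g + 13 / 24 / √x) := by gcongr
  have h11 := (neg_abs_le _).trans' (neg_le_neg htail)
  have h12 : x * (1 / √x ^ 2 + (1 + 2 + 2 * 0) / √x) = 1 + 3 * √x := by
    rw [hyx]
    have : x / √x = √x := div_sqrt
    field_simp
    nlinarith
  have h13 := mul_le_mul_of_nonneg_left h11 (by linarith : 0 ≤ x)
  rw [hT]
  nlinarith

/-! ### Absorption of the error terms -/

/-- Logarithm bound by the tangent line at `a`. -/
lemma log_le_div_sub_one_add_log {z a : ℝ} (hz : 0 < z) (ha : 0 < a) :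
    log z ≤ z / a - 1 + log a := by
  have h := log_le_sub_one_of_pos (div_pos hz ha)
  rw [log_div hz.ne' ha.ne'] at h
  linarith

/-- The substitution `x = z ^ 6` turns all powers of `x` into powers of `z`; what remains is an
inequality between `z ^ 3`, `z ^ 4` and `z ^ 3 * log z`, where `log z` is bounded by its tangent at
`6 / 5`. -/
theorem sum_two_pow_omega_le_explicit {x : ℝ} (hx : 1 ≤ x) :
    ∑ n ∈ Icc 1 ⌊x⌋₊, (2 : ℝ) ^ ArithmeticFunction.cardDistinctFactors n
      ≤ 6 / π ^ 2 * x * log x + 0.787 * x - 0.3762 + 8.14 * x ^ (2 / 3 : ℝ) := by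
  have hmain := sum_two_pow_omega_le hx
  have hA : moebiusLog 0 = 6 / π ^ 2 := by rw [moebiusLog_zero, zetaLog_zero, inv_div]
  have hA1 : 0.607926 < moebiusLog 0 := by rw [moebiusLog_zero]; exact zetaLog_zero_inv_bounds.1
  have hB := linear_coeff_le
  obtain ⟨-, g2⟩ := eulerMascheroniConstant_bounds
  set z : ℝ := x ^ (1 / 6 : ℝ) with hz
  have hz1 : 1 ≤ z := one_le_rpow hx (by norm_num)
  have hz6 : z ^ 6 = x := by
    rw [hz, ← rpow_natCast, ← rpow_mul (by linarith)]; norm_num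
  have hz4 : x ^ (2 / 3 : ℝ) = z ^ 4 := by
    rw [hz, ← rpow_natCast, ← rpow_mul (by linarith)]; norm_num
  have hz3 : √x = z ^ 3 := by
    rw [← hz6, show z ^ 6 = (z ^ 3) ^ 2 by ring, sqrt_sq (by positivity)]
  have hL : log x = 6 * log z := by rw [← hz6, log_pow]; norm_num
  rw [hz3] at hmain
  have e1 : 37 / 12 * z ^ 3 * (log x / 2 + eulerMascheroniConstant + 13 / 24 / z ^ 3)
      = 37 / 4 * (z ^ 3 * log z) + 37 / 12 * eulerMascheroniConstant * z ^ 3 + 481 / 288 := by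
    rw [hL]; field_simp; ring
  rw [e1] at hmain
  have hlog : log z ≤ z / 1.2 - 1 + 0.18233 := by
    have h := log_le_div_sub_one_add_log (z := z) (a := 1.2) (by linarith) (by norm_num)
    have e : log 1.2 = log 2 + log 3 - log 5 := by
      rw [show (1.2 : ℝ) = 2 * 3 / 5 by norm_num, log_div (by norm_num) (by norm_num),
        log_mul (by norm_num) (by norm_num)]
    have := log_two_lt_d9
    have := log_three_lt_d9
    have := log_five_gt_d9
    rw [e] at h
    linarith
  have h3 : 1 ≤ z ^ 3 := one_le_pow₀ hz1
  have h4 : 1 ≤ z ^ 4 := one_le_pow₀ hz1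
  have e2 : z ^ 3 * log z ≤ z ^ 4 / 1.2 - 0.81767 * z ^ 3 := by
    have := mul_le_mul_of_nonneg_left hlog (by linarith : 0 ≤ z ^ 3)
    have e : z ^ 3 * (z / 1.2 - 1 + 0.18233) = z ^ 4 / 1.2 - 0.81767 * z ^ 3 := by ring
    linarith
  have e3 : eulerMascheroniConstant * z ^ 3 ≤ 0.577216 * z ^ 3 := by gcongr
  have e4 : x * (moebiusLog 0 * log x + (2 * eulerMascheroniConstant * moebiusLog 0
      - 2 * moebiusLog 1) - moebiusLog 0) ≤ 6 / π ^ 2 * x * log x + 0.787 * x := by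
    have : x * (2 * eulerMascheroniConstant * moebiusLog 0 - 2 * moebiusLog 1 - moebiusLog 0)
        ≤ x * 0.787 := by
      refine mul_le_mul_of_nonneg_left ?_ (by linarith)
      norm_num at hA1 hB ⊢
      linarith
    rw [hA] at this ⊢
    linarith
  rw [hz4]
  norm_num at e2 e3 e4 hmain ⊢
  linarith

/-- The threshold is `172 > 2.35 ^ 6`; in terms of `z = x ^ (1 / 6)` the tangent of `log z` is taken
at `12 / 5`. -/
lemma sum_two_pow_omega_div_le_of_large {x : ℝ} (hx : 172 ≤ x) :
    ∑ n ∈ Icc 1 ⌊x⌋₊, (2 : ℝ) ^ ArithmeticFunction.cardDistinctFactors n / (n : ℝ)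
      ≤ 3 / π ^ 2 * log x ^ 2 + 1.3949 * log x + 0.4107 + 3.253 * x ^ (-(1 / 3) : ℝ) := by
  have hmain := sum_two_pow_omega_div_le (x := x) (by linarith)
  have hA : moebiusLog 0 * (log x ^ 2 / 2) = 3 / π ^ 2 * log x ^ 2 := by
    rw [moebiusLog_zero, zetaLog_zero, inv_div]; ring
  have hB := linear_coeff_le
  have hC := constant_coeff_le
  obtain ⟨g1, g2⟩ := eulerMascheroniConstant_bounds
  set z : ℝ := x ^ (1 / 6 : ℝ) with hz
  have hz6 : z ^ 6 = x := by
    rw [hz, ← rpow_natCast, ← rpow_mul (by linarith)]; norm_num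
  have hz0 : 0 < z := by positivity
  have hz1 : 2.35 ≤ z := by
    by_contra! h
    have : z ^ 6 < 2.35 ^ 6 := by gcongr
    norm_num at this
    linarith
  have hz2 : x ^ (-(1 / 3) : ℝ) = 1 / z ^ 2 := by
    rw [rpow_neg (by linarith), hz, ← rpow_natCast, ← rpow_mul (by linarith)]; norm_num
  have hz3 : √x = z ^ 3 := by
    rw [← hz6, show z ^ 6 = (z ^ 3) ^ 2 by ring, sqrt_sq (by positivity)]
  have hL : log x = 6 * log z := by rw [← hz6, log_pow]; norm_num
  have hL0 : 0 ≤ log x := log_nonneg (by linarith)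
  -- The rounding of the linear coefficient and a part of the error term `x ^ (-1 / 3)` pay for the
  -- rounding of the constant term: bound `-log (1 / z ^ 2)` from below by its tangent at `1 / 200`.
  have hround : 0.412 - 0.4107 ≤ (1.3949 - 1.394821) * log x + 0.05 * (1 / z ^ 2) := by
    have h := log_le_div_sub_one_add_log (z := 1 / z ^ 2) (a := 1 / 200) (by positivity)
      (by norm_num)
    have e : log (1 / z ^ 2) = -(2 * log z) := by
      rw [one_div, log_inv, log_pow]; norm_num
    have e200 : log (1 / 200) = -(3 * log 2 + 2 * log 5) := by
      rw [one_div, log_inv, show (200 : ℝ) = 2 ^ 3 * 5 ^ 2 by norm_num,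
        log_mul (by norm_num) (by norm_num), log_pow, log_pow]
      norm_num
    rw [e, e200] at h
    have h2 := log_two_gt_d9
    have h5 := log_five_gt_d9
    have h0 : 0 < 1 / z ^ 2 := by positivity
    rw [hL]
    generalize 1 / z ^ 2 = s at h h0 ⊢
    norm_num at h h2 h5 ⊢
    linarith
  have hlog : log z ≤ z / 2.4 - 1 + 0.8755 := by
    have h := log_le_div_sub_one_add_log (z := z) (a := 2.4) (by linarith) (by norm_num)
    have e : log 2.4 = 2 * log 2 + log 3 - log 5 := by
      rw [show (2.4 : ℝ) = 2 ^ 2 * 3 / 5 by norm_num, log_div (by norm_num) (by norm_num),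
        log_mul (by norm_num) (by norm_num), log_pow]
      norm_num
    have := log_two_lt_d9
    have := log_three_lt_d9
    have := log_five_gt_d9
    rw [e] at h
    linarith
  have herr : (1.17 / x + (5.17 - 4 * eulerMascheroniConstant) / √x)
      + (13 / 12 * (log x / 2 + eulerMascheroniConstant + 13 / 24 / √x) + 1) / √x
      ≤ 3.203 * (1 / z ^ 2) := by
    have e : (1.17 / x + (5.17 - 4 * eulerMascheroniConstant) / √x)
        + (13 / 12 * (log x / 2 + eulerMascheroniConstant + 13 / 24 / √x) + 1) / √x
        = ((1.17 + 169 / 288) * (1 / z ^ 3) + 6.17 - 35 / 12 * eulerMascheroniConstant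
          + 13 / 4 * log z) / z ^ 3 := by
      rw [hz3, ← hz6, log_pow]
      field_simp
      push_cast
      ring
    rw [e, div_le_iff₀ (by positivity), show 3.203 * (1 / z ^ 2) * z ^ 3 = 3.203 * z by field_simp]
    have h3 : 1 / z ^ 3 ≤ 1 / 2.35 ^ 3 := by gcongr
    norm_num at h3 hlog hz1 g1 ⊢
    linarith
  have hBL := mul_le_mul_of_nonneg_right hB hL0
  rw [hA] at hmain
  rw [hz2]
  norm_num at hmain hBL hround herr hC ⊢
  linarith

/-! ### Small values of `x` -/

/-- The bound for `∑ n ≤ x, 2 ^ ω(n) / n` is increasing in `x`: with `s = x ^ (-1 / 3)`, the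
derivative of `-3 * 1.3949 * log s + 3.253 * s` is negative on `(0, 1]`. -/
lemma bound_mono {a x : ℝ} (ha : 1 ≤ a) (hax : a ≤ x) :
    3 / π ^ 2 * log a ^ 2 + 1.3949 * log a + 0.4107 + 3.253 * a ^ (-(1 / 3) : ℝ)
      ≤ 3 / π ^ 2 * log x ^ 2 + 1.3949 * log x + 0.4107 + 3.253 * x ^ (-(1 / 3) : ℝ) := by
  have h1 : log a ≤ log x := log_le_log (by linarith) hax
  have h0 : 0 ≤ log a := log_nonneg ha
  have h2 : 3 / π ^ 2 * log a ^ 2 ≤ 3 / π ^ 2 * log x ^ 2 := by gcongr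
  have hs : 0 < a ^ (-(1 / 3) : ℝ) := by positivity
  have hs1 : a ^ (-(1 / 3) : ℝ) ≤ 1 := rpow_le_one_of_one_le_of_nonpos ha (by norm_num)
  have ht : 0 < x ^ (-(1 / 3) : ℝ) := rpow_pos_of_pos (by linarith) _
  have hts : x ^ (-(1 / 3) : ℝ) ≤ a ^ (-(1 / 3) : ℝ) :=
    rpow_le_rpow_of_nonpos (by linarith) hax (by norm_num)
  have h3 := log_le_div_sub_one_add_log ht hs
  rw [log_rpow (by linarith), log_rpow (by linarith)] at h3
  have h4 : x ^ (-(1 / 3) : ℝ) / a ^ (-(1 / 3) : ℝ) - 1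
      ≤ x ^ (-(1 / 3) : ℝ) - a ^ (-(1 / 3) : ℝ) := by
    rw [div_sub_one hs.ne', div_le_iff₀ hs]
    nlinarith
  linarith

/-- On an interval `[a, b)` it suffices to compare the sum up to `b - 1` with the bound at `a`. Here
`a = 2 ^ i * 3 ^ j * 5 ^ k`, and `s` is a lower bound of `a ^ (-1 / 3)`. -/
lemma sum_two_pow_omega_div_le_of_mem_Ico {i j k b : ℕ} {s q : ℚ}
    (hT : ∑ n ∈ Icc 1 (b - 1), (2 : ℚ) ^ ArithmeticFunction.cardDistinctFactors n / (n : ℚ) ≤ q)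
    (hs : s ^ 3 * (2 ^ i * 3 ^ j * 5 ^ k) ≤ 1)
    (hq : q ≤ 0.30396 * (0.6931 * i + 1.0986 * j + 1.6094 * k) ^ 2
      + 1.3949 * (0.6931 * i + 1.0986 * j + 1.6094 * k) + 0.4107 + 3.253 * s)
    {x : ℝ} (hax : 2 ^ i * 3 ^ j * 5 ^ k ≤ x) (hxb : x < b) :
    ∑ n ∈ Icc 1 ⌊x⌋₊, (2 : ℝ) ^ ArithmeticFunction.cardDistinctFactors n / (n : ℝ)
      ≤ 3 / π ^ 2 * log x ^ 2 + 1.3949 * log x + 0.4107 + 3.253 * x ^ (-(1 / 3) : ℝ) := by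
  set a : ℝ := 2 ^ i * 3 ^ j * 5 ^ k with ha
  have ha1 : 1 ≤ a := by
    rw [ha]
    exact_mod_cast Nat.one_le_iff_ne_zero.2 (by positivity : 2 ^ i * 3 ^ j * 5 ^ k ≠ 0)
  have hT' : ∑ n ∈ Icc 1 (b - 1),
      (2 : ℝ) ^ ArithmeticFunction.cardDistinctFactors n / (n : ℝ) ≤ (q : ℝ) := by
    have := (Rat.cast_le (K := ℝ)).2 hT
    push_cast at this
    exact this
  have hsub : Icc 1 ⌊x⌋₊ ⊆ Icc 1 (b - 1) := by
    have := (Nat.floor_lt (by linarith)).2 hxb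
    exact Icc_subset_Icc_right (by omega)
  refine ((sum_le_sum_of_subset_of_nonneg hsub fun n _ _ => by positivity).trans hT').trans
    (le_trans ?_ (bound_mono ha1 hax))
  have hs' : (s : ℝ) ^ 3 * a ≤ 1 := by rw [ha]; exact_mod_cast hs
  have hsa : (s : ℝ) ≤ a ^ (-(1 / 3) : ℝ) := by
    by_contra! h
    have h1 : (a ^ (-(1 / 3) : ℝ)) ^ 3 < (s : ℝ) ^ 3 := by gcongr
    rw [← rpow_natCast, ← rpow_mul (by linarith)] at h1
    have e : a ^ (-(1 / 3) * ((3 : ℕ) : ℝ) : ℝ) = 1 / a := by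
      rw [show (-(1 / 3) * ((3 : ℕ) : ℝ) : ℝ) = -1 by norm_num, rpow_neg_one, one_div]
    rw [e, div_lt_iff₀ (by linarith)] at h1
    linarith
  set l : ℝ := 0.6931 * i + 1.0986 * j + 1.6094 * k with hl
  have hla : l ≤ log a := by
    rw [ha, log_mul (by positivity) (by positivity), log_mul (by positivity) (by positivity),
      log_pow, log_pow, log_pow, hl]
    have h2 : 0.6931 * i ≤ i * log 2 := by
      rw [mul_comm]; gcongr; linarith [log_two_gt_d9]
    have h3 : 1.0986 * j ≤ j * log 3 := by
      rw [mul_comm]; gcongr; linarith [log_three_gt_d9]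
    have h5 : 1.6094 * k ≤ k * log 5 := by
      rw [mul_comm]; gcongr; linarith [log_five_gt_d9]
    linarith
  have hl0 : 0 ≤ l := by positivity
  have hq' : (q : ℝ) ≤ 0.30396 * l ^ 2 + 1.3949 * l + 0.4107 + 3.253 * (s : ℝ) := by
    have := (Rat.cast_le (K := ℝ)).2 hq
    push_cast at this
    exact this
  have hpi : 0.30396 ≤ 3 / π ^ 2 := by
    have h1 : π ^ 2 < 3.141593 ^ 2 := by gcongr; exact pi_lt_d6
    rw [le_div_iff₀ (by positivity)]
    norm_num at h1 ⊢
    linarith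
  have h2 : 0.30396 * l ^ 2 ≤ 3 / π ^ 2 * log a ^ 2 := by gcongr
  linarith

set_option maxRecDepth 10000 in
/-- The points `a` are spaced so that the term `3.253 * a ^ (-1 / 3)` of the bound at `a` leaves
room for the growth of the sum up to the next point. -/
lemma sum_two_pow_omega_div_le_of_small {x : ℝ} (hx1 : 1 ≤ x) (hx : x < 172) :
    ∑ n ∈ Icc 1 ⌊x⌋₊, (2 : ℝ) ^ ArithmeticFunction.cardDistinctFactors n / (n : ℝ)
      ≤ 3 / π ^ 2 * log x ^ 2 + 1.3949 * log x + 0.4107 + 3.253 * x ^ (-(1 / 3) : ℝ) := by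
  rcases lt_or_ge x 6 with h6 | h6
  · exact sum_two_pow_omega_div_le_of_mem_Ico (i := 0) (j := 0) (k := 0) (b := 6) (s := 1.000)
      (q := 3.57) (by decide +kernel) (by norm_num) (by norm_num) (by norm_num; linarith)
      (by norm_num; linarith)
  rcases lt_or_ge x 12 with h12 | h12
  · exact sum_two_pow_omega_div_le_of_mem_Ico (i := 1) (j := 1) (k := 0) (b := 12) (s := 0.550)
      (q := 5.58) (by decide +kernel) (by norm_num) (by norm_num) (by norm_num; linarith)
      (by norm_num; linarith)
  rcases lt_or_ge x 18 with h18 | h18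
  · exact sum_two_pow_omega_div_le_of_mem_Ico (i := 2) (j := 1) (k := 0) (b := 18) (s := 0.436)
      (q := 6.86) (by decide +kernel) (by norm_num) (by norm_num) (by norm_num; linarith)
      (by norm_num; linarith)
  rcases lt_or_ge x 25 with h25 | h25
  · exact sum_two_pow_omega_div_le_of_mem_Ico (i := 1) (j := 2) (k := 0) (b := 25) (s := 0.381)
      (q := 8.01) (by decide +kernel) (by norm_num) (by norm_num) (by norm_num; linarith)
      (by norm_num; linarith)
  rcases lt_or_ge x 32 with h32 | h32
  · exact sum_two_pow_omega_div_le_of_mem_Ico (i := 0) (j := 0) (k := 2) (b := 32) (s := 0.341)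
      (q := 8.86) (by decide +kernel) (by norm_num) (by norm_num) (by norm_num; linarith)
      (by norm_num; linarith)
  rcases lt_or_ge x 40 with h40 | h40
  · exact sum_two_pow_omega_div_le_of_mem_Ico (i := 5) (j := 0) (k := 0) (b := 40) (s := 0.314)
      (q := 9.65) (by decide +kernel) (by norm_num) (by norm_num) (by norm_num; linarith)
      (by norm_num; linarith)
  rcases lt_or_ge x 50 with h50 | h50
  · exact sum_two_pow_omega_div_le_of_mem_Ico (i := 3) (j := 0) (k := 1) (b := 50) (s := 0.292)
      (q := 10.47) (by decide +kernel) (by norm_num) (by norm_num) (by norm_num; linarith)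
      (by norm_num; linarith)
  rcases lt_or_ge x 60 with h60 | h60
  · exact sum_two_pow_omega_div_le_of_mem_Ico (i := 1) (j := 0) (k := 2) (b := 60) (s := 0.271)
      (q := 11.14) (by decide +kernel) (by norm_num) (by norm_num) (by norm_num; linarith)
      (by norm_num; linarith)
  rcases lt_or_ge x 72 with h72 | h72
  · exact sum_two_pow_omega_div_le_of_mem_Ico (i := 2) (j := 1) (k := 1) (b := 72) (s := 0.255)
      (q := 11.93) (by decide +kernel) (by norm_num) (by norm_num) (by norm_num; linarith)
      (by norm_num; linarith)
  rcases lt_or_ge x 81 with h81 | h81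
  · exact sum_two_pow_omega_div_le_of_mem_Ico (i := 3) (j := 2) (k := 0) (b := 81) (s := 0.240)
      (q := 12.41) (by decide +kernel) (by norm_num) (by norm_num) (by norm_num; linarith)
      (by norm_num; linarith)
  rcases lt_or_ge x 96 with h96 | h96
  · exact sum_two_pow_omega_div_le_of_mem_Ico (i := 0) (j := 4) (k := 0) (b := 96) (s := 0.231)
      (q := 13.11) (by decide +kernel) (by norm_num) (by norm_num) (by norm_num; linarith)
      (by norm_num; linarith)
  rcases lt_or_ge x 108 with h108 | h108
  · exact sum_two_pow_omega_div_le_of_mem_Ico (i := 5) (j := 1) (k := 0) (b := 108) (s := 0.218)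
      (q := 13.58) (by decide +kernel) (by norm_num) (by norm_num) (by norm_num; linarith)
      (by norm_num; linarith)
  rcases lt_or_ge x 125 with h125 | h125
  · exact sum_two_pow_omega_div_le_of_mem_Ico (i := 2) (j := 3) (k := 0) (b := 125) (s := 0.209)
      (q := 14.22) (by decide +kernel) (by norm_num) (by norm_num) (by norm_num; linarith)
      (by norm_num; linarith)
  rcases lt_or_ge x 144 with h144 | h144
  · exact sum_two_pow_omega_div_le_of_mem_Ico (i := 0) (j := 0) (k := 3) (b := 144) (s := 0.200)
      (q := 14.85) (by decide +kernel) (by norm_num) (by norm_num) (by norm_num; linarith)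
      (by norm_num; linarith)
  rcases lt_or_ge x 162 with h162 | h162
  · exact sum_two_pow_omega_div_le_of_mem_Ico (i := 4) (j := 2) (k := 0) (b := 162) (s := 0.190)
      (q := 15.36) (by decide +kernel) (by norm_num) (by norm_num) (by norm_num; linarith)
      (by norm_num; linarith)
  exact sum_two_pow_omega_div_le_of_mem_Ico (i := 1) (j := 4) (k := 0) (b := 172) (s := 0.183)
    (q := 15.64) (by decide +kernel) (by norm_num) (by norm_num) (by norm_num; linarith)
    (by norm_num; linarith)

theorem mainTheorem7 :
    (∀ x : ℝ, 1 ≤ x →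
      ∑ n ∈ Finset.Icc 1 ⌊x⌋₊,
          (2 : ℝ) ^ (ArithmeticFunction.cardDistinctFactors n) / (n : ℝ)
        ≤ 3 / Real.pi ^ 2 * (Real.log x) ^ 2 + 1.3949 * Real.log x + 0.4107
          + 3.253 * x ^ (-(1 / 3) : ℝ)) ∧
    (∀ x : ℝ, 1 < x →
      ∑ n ∈ Finset.Icc 1 ⌊x⌋₊,
          (2 : ℝ) ^ (ArithmeticFunction.cardDistinctFactors n)
        ≤ 6 / Real.pi ^ 2 * x * Real.log x + 0.787 * x - 0.3762
          + 8.14 * x ^ (2 / 3 : ℝ)) := by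
  refine ⟨fun x hx => ?_, fun x hx => sum_two_pow_omega_le_explicit hx.le⟩
  rcases lt_or_ge x 172 with h | h
  · exact sum_two_pow_omega_div_le_of_small hx h
  · exact sum_two_pow_omega_div_le_of_large h
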